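/- Let $G$ be a connected complex reductive algebraic group with Lie algebra $\mathfrak g$. Fix a Cartan decomposition $\mathfrak g=\mathfrak n^-\oplus\mathfrak t\oplus\mathfrak n^+$, where $\mathfrak t$ is the Lie algebra of a maximal torus $T\subset G$ and $\mathfrak n^{\pm}$ are the sums of the root spaces of the positive, respectively negative, roots for a system $\Phi^+$ of positive roots; let $U,U^-\subset G$ be the maximal unipotent subgroups with Lie algebras $\mathfrak n^+,\mathfrak n^-$, and let $\mathbb C[G/\!/U]=\mathbb C[G]^{U}$ be the algebra of regular functions on $G$ invariant under right multiplication by $U$. For $\beta\in\Phi^+$ fix a nonzero root vector $f_\beta\in\mathfrak g_{-\beta}$. Let $N=|\Phi^+|$ and let $S=(\beta_1,\dots,\beta_N)$ be a birational sequence: a sequence of positive roots (repetitions allowed) such that $\mathbb A^N\to U^-$, $(z_1,\dots,z_N)\mapsto \exp(z_1f_{\beta_1})\cdots\exp(z_Nf_{\beta_N})$, is birational. For $\mathbf m\in\mathbb N^N$ put $\mathbf f^{(\mathbf m)}=\frac{f_{\beta_1}^{m_1}}{m_1!}\cdots\frac{f_{\beta_N}^{m_N}}{m_N!}$. Let $>$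 be a $\Psi$-weighted lex order on $\mathbb N^N$: for some $\mathbb Z$-linear $\Psi:\mathbb Z^N\to\mathbb Z$ with $\Psi(\mathbb N^N)\subseteq\mathbb N$, one compares $\Psi(\mathbf m)$ first and breaks ties either by the lexicographic or right lexicographic order, or, provided $\Psi(\mathbf m)>0$ for all $\mathbf m\in\mathbb N^N\setminus\{0\}$, by the opposite of one of these. For a dominant weight $\lambda$ of $T$ let $V(\lambda)$ be the irreducible rational representation of $G$ of highest weight $\lambda$ with highest weight vector $v_\lambda$. Let $es(\lambda)$ be the set of $\mathbf m\in\mathbb N^N$ with $\langle \mathbf f^{(\mathbf k)}v_\lambda\mid\mathbf k<\mathbf m\rangle\neq\langle \mathbf f^{(\mathbf k)}v_\lambda\mid\mathbf k\le\mathbf m\rangle$. Then $\{\mathbf f^{(\mathbf p)}v_\lambda\mid \mathbf p\in es(\lambda)\}$ is a basis of $V(\lambda)$. Let $\{\xi_{\lambda,\mathbf p}\mid \mathbf p\in es(\lambda)\}$ be the dual basis of $V(\lambda)^*$, and regard $\xi_{\lambda,\mathbf p}$ as the element $g\mapsto \xi_{\lambda,\mathbf p}(g v_\lambda)$ of $\mathbb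 C[G/\!/U]$. Then for all dominant weights $\lambda,\mu$, all $\mathbf p\in es(\lambda)$ and all $\mathbf q\in es(\mu)$: one has $\mathbf p+\mathbf q\in es(\lambda+\mu)$; there are unique constants $c_{\mathbf r}=c_{\lambda,\mathbf p;\mu,\mathbf q}^{\lambda+\mu,\mathbf r}\in\mathbb C$, $\mathbf r\in es(\lambda+\mu)$, with $$\xi_{\lambda,\mathbf p}\,\xi_{\mu,\mathbf q}=\sum_{\mathbf r\in es(\lambda+\mu)}c_{\mathbf r}\,\xi_{\lambda+\mu,\mathbf r}\quad\text{in }\mathbb C[G/\!/U];$$ and $$\xi_{\lambda,\mathbf p}\,\xi_{\mu,\mathbf q}=\xi_{\lambda+\mu,\mathbf p+\mathbf q}+\sum_{\mathbf r\in es(\lambda+\mu),\ \mathbf r>\mathbf p+\mathbf q}c_{\mathbf r}\,\xi_{\lambda+\mu,\mathbf r}.$$ -/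

import Mathlib

noncomputable section

namespace DualEssential

/-! ### Linear algebraic groups over `ℂ`, as Zariski closed subgroups of `GL n ℂ` -/

abbrev MatC (n : ℕ) := Matrix (Fin n) (Fin n) ℂ

abbrev GLC (n : ℕ) := Matrix.GeneralLinearGroup (Fin n) ℂ

variable {n : ℕ}

/-- `H` is the zero locus in `GL n ℂ` of a set of polynomials in the matrix entries. -/
def IsZariskiClosed (H : Subgroup (GLC n)) : Prop :=
  ∃ I : Set (MvPolynomial (Fin n × Fin n) ℂ), ∀ g : GLC n,
    g ∈ H ↔ ∀ P ∈ I, MvPolynomial.eval (fun ij => (g : MatC n) ij.1 ij.2) P = 0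

/-- The coordinate ring `ℂ[H]`: the functions on `H` that are polynomial in the matrix entries
and the inverse of the determinant. -/
def coordRing (H : Subgroup (GLC n)) : Subalgebra ℂ (H → ℂ) :=
  Algebra.adjoin ℂ
    ({φ | ∃ i j, φ = fun h : H => ((h : GLC n) : MatC n) i j} ∪
      {fun h : H => (((h : GLC n) : MatC n).det)⁻¹})

/-- Connectedness in the Zariski topology. -/
def IsZariskiConnected (H : Subgroup (GLC n)) : Prop :=
  ConnectedSpace (PrimeSpectrum (coordRing H))

/-- A torus: a closed connected diagonalizable subgroup. -/
structure IsTorus (T : Subgroup (GLC n)) : Prop where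
  closed : IsZariskiClosed T
  connected : IsZariskiConnected T
  diagonalizable : ∃ P : GLC n, ∀ t ∈ T, ((P * t * P⁻¹ : GLC n) : MatC n).IsDiag

/-- A rational representation: all matrix coefficients are regular functions on `G`. -/
def IsRational {G : Subgroup (GLC n)} {V : Type*} [AddCommGroup V] [Module ℂ V]
    (ρ : Representation ℂ G V) : Prop :=
  ∀ (φ : Module.Dual ℂ V) (v : V), (fun g : G => φ (ρ g v)) ∈ coordRing G

/-- A connected complex reductive algebraic group: a connected linear algebraic group
all of whose finite dimensional rational representations are completely reducible. -/
structure IsConnectedReductive (G : Subgroup (GLC n)) : Prop where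
  closed : IsZariskiClosed G
  connected : IsZariskiConnected G
  reductive : ∀ (V : Type) [AddCommGroup V] [Module ℂ V] [FiniteDimensional ℂ V]
    (ρ : Representation ℂ G V), IsRational ρ → ρ.IsSemisimpleRepresentation

/-! ### Lie algebras and exponentials -/

/-- The exponential of a matrix, as an invertible matrix. -/
def expGL (X : MatC n) : GLC n := (Matrix.isUnit_exp X).unit

/-- The Lie algebra of `H`: the matrices all of whose complex one-parameter groups lie in `H`. -/
def lieAlg (H : Subgroup (GLC n)) : Set (MatC n) :=
  {X | ∀ s : ℂ, expGL (s • X) ∈ H}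

/-- `exp (s X)` as an element of `H`, for `X` in the Lie algebra of `H`. -/
def expElt {H : Subgroup (GLC n)} (X : lieAlg H) (s : ℂ) : H := ⟨expGL (s • X.1), X.2 s⟩

/-- The action of `X ∈ Lie G` on a representation, `v ↦ d/ds (ρ (exp (s X)) v)` at `s = 0`,
computed in coordinates with respect to a basis of `V`. -/
def dRep {G : Subgroup (GLC n)} {V : Type*} [AddCommGroup V] [Module ℂ V]
    [FiniteDimensional ℂ V] (ρ : Representation ℂ G V) (X : lieAlg G) : Module.End ℂ V :=
  let b := Module.finBasis ℂ V
  b.constr ℂ fun j => ∑ i, deriv (fun s : ℂ => b.repr (ρ (expElt X s) (b j)) i) 0 • b i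

/-! ### Characters, roots, Cartan decompositions -/

/-- The character lattice `Λ` of `T`, i.e. the group of morphisms of algebraic groups `T → ℂˣ`,
written multiplicatively: the weight `λ + μ` is the product `λ * μ`, and `-β` is `β⁻¹`. -/
def charLattice (T : Subgroup (GLC n)) : Subgroup (T →* ℂˣ) where
  carrier := {χ | (fun t => (χ t : ℂ)) ∈ coordRing T ∧ (fun t => ((χ t)⁻¹ : ℂ)) ∈ coordRing T}
  one_mem' := by
    constructor
    · convert (coordRing T).one_mem using 1
      ext t
      simp
    · convert (coordRing T).one_mem using 1
      ext t
      simp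
  mul_mem' := by
    rintro a b ⟨ha, ha'⟩ ⟨hb, hb'⟩
    refine ⟨?_, ?_⟩
    · convert (coordRing T).mul_mem ha hb using 1
      ext t
      simp
    · convert (coordRing T).mul_mem ha' hb' using 1
      ext t
      simp [mul_comm]
  inv_mem' := by
    rintro a ⟨ha, ha'⟩
    refine ⟨?_, ?_⟩
    · simpa using ha'
    · simpa using ha

/-- The weight space of weight `α` of `T` acting on `Lie G` by conjugation. -/
def rootSpace (G T : Subgroup (GLC n)) (α : charLattice T) : Set (MatC n) :=
  {X | X ∈ lieAlg G ∧
    ∀ t : T, ((t : GLC n) : MatC n) * X * (((t : GLC n)⁻¹ : GLC n) : MatC n) =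
      ((α.1 t : ℂˣ) : ℂ) • X}

/-- The roots: the nontrivial weights of `T` on `Lie G`. -/
def IsRoot (G T : Subgroup (GLC n)) (α : charLattice T) : Prop :=
  α ≠ 1 ∧ ∃ X ∈ rootSpace G T α, X ≠ 0

/-- A Cartan decomposition `𝔤 = 𝔫⁻ ⊕ 𝔱 ⊕ 𝔫⁺`: a torus `T ≤ G` whose Lie algebra is the
full zero weight space of `T` on `𝔤` (for reductive `G` this says that `T` is a maximal torus),
together with a system of positive roots, i.e. the roots which are positive for a linear
functional on `Λ` that vanishes on no root. -/
structure CartanDecomposition (G : Subgroup (GLC n)) where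
  T : Subgroup (GLC n)
  T_le : T ≤ G
  isTorus : IsTorus T
  zero_weight : rootSpace G T 1 = lieAlg T
  pos : Set (charLattice T)
  isPositiveSystem : ∃ l : Additive (charLattice T) →+ ℝ,
    (∀ α, IsRoot G T α → l (Additive.ofMul α) ≠ 0) ∧
    pos = {α | IsRoot G T α ∧ 0 < l (Additive.ofMul α)}

namespace CartanDecomposition

variable {G : Subgroup (GLC n)} (D : CartanDecomposition G)

/-- The maximal unipotent subgroup `U` with Lie algebra `𝔫⁺`, generated by the
root subgroups of the positive roots. -/
def U : Subgroup (GLC n) :=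
  Subgroup.closure {g | ∃ α ∈ D.pos, ∃ X ∈ rootSpace G D.T α, ∃ s : ℂ, g = expGL (s • X)}

/-- The maximal unipotent subgroup `U⁻` with Lie algebra `𝔫⁻`, generated by the
root subgroups of the negative roots. -/
def Uminus : Subgroup (GLC n) :=
  Subgroup.closure {g | ∃ α ∈ D.pos, ∃ X ∈ rootSpace G D.T α⁻¹, ∃ s : ℂ, g = expGL (s • X)}

/-- The coordinate ring `ℂ[G//U] = ℂ[G]^U` of regular functions on `G` that are invariant under
right multiplication by `U`. -/
def coordRingModU : Subalgebra ℂ (G → ℂ) where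
  carrier := {φ | φ ∈ coordRing G ∧ ∀ g u : G, (u : GLC n) ∈ D.U → φ (g * u) = φ g}
  mul_mem' := by
    rintro a b ⟨ha, ha'⟩ ⟨hb, hb'⟩
    refine ⟨(coordRing G).mul_mem ha hb, fun g u hu => ?_⟩
    simp [ha' g u hu, hb' g u hu]
  add_mem' := by
    rintro a b ⟨ha, ha'⟩ ⟨hb, hb'⟩
    refine ⟨(coordRing G).add_mem ha hb, fun g u hu => ?_⟩
    simp [ha' g u hu, hb' g u hu]
  algebraMap_mem' := fun c => ⟨(coordRing G).algebraMap_mem c, fun _ _ _ => rfl⟩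

/-- A choice of a nonzero root vector `f_β` of weight `-β` for every positive root `β`. -/
structure RootVectors where
  vec : D.pos → MatC n
  mem : ∀ β : D.pos, vec β ∈ rootSpace G D.T (β : charLattice D.T)⁻¹
  ne_zero : ∀ β, vec β ≠ 0

variable {D}

/-- `f_β` as an element of `Lie G`. -/
def RootVectors.lie (f : D.RootVectors) (β : D.pos) : lieAlg G := ⟨f.vec β, (f.mem β).1⟩

/-- `exp (z f_β)` as an element of `U⁻`. -/
def RootVectors.exp (f : D.RootVectors) (β : D.pos) (z : ℂ) : D.Uminus :=
  ⟨expGL (z • f.vec β),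
    Subgroup.subset_closure ⟨β, β.2, f.vec β, f.mem β, z, rfl⟩⟩

variable {N : ℕ}

/-- The product map `π : ℂ^N → U⁻`, `z ↦ exp (z₁ f_{β₁}) ⋯ exp (z_N f_{β_N})`. -/
def prodMap (f : D.RootVectors) (S : Fin N → D.pos) (z : Fin N → ℂ) : D.Uminus :=
  (List.ofFn fun i => f.exp (S i) (z i)).prod

/-- `S = (β₁, …, β_N)` is a birational sequence: the morphism `π : ℂ^N → U⁻` is dominant
(the comorphism is injective on `ℂ[U⁻]`) and induces an isomorphism of function fields
(every coordinate `z_i` lies in the image of the field of fractions of `ℂ[U⁻]`). -/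
structure IsBirationalSequence (f : D.RootVectors) (S : Fin N → D.pos) : Prop where
  dominant : ∀ a ∈ coordRing D.Uminus, (∀ z, a (prodMap f S z) = 0) → a = 0
  birational : ∀ i, ∃ a ∈ coordRing D.Uminus, ∃ b ∈ coordRing D.Uminus, b ≠ 0 ∧
    ∀ z, b (prodMap f S z) * z i = a (prodMap f S z)

variable (D)

/-- `V` is an irreducible rational representation of `G` with highest weight vector `v` of
highest weight `wt`. -/
structure IsHighestWeightRep {V : Type*} [AddCommGroup V] [Module ℂ V]
    (wt : charLattice D.T) (ρ : Representation ℂ G V) (v : V) : Prop where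
  rational : IsRational ρ
  irreducible : ρ.IsIrreducible
  ne_zero : v ≠ 0
  weight : ∀ (g : G) (hg : (g : GLC n) ∈ D.T), ρ g v = ((wt.1 ⟨g, hg⟩ : ℂˣ) : ℂ) • v
  unipotent : ∀ g : G, (g : GLC n) ∈ D.U → ρ g v = v

variable {D}

/-- The element `g ↦ φ (g v)` of `ℂ[G//U]` given by a linear form `φ ∈ V(wt)*`. -/
def IsHighestWeightRep.toFun {V : Type*} [AddCommGroup V] [Module ℂ V]
    {wt : charLattice D.T} {ρ : Representation ℂ G V} {v : V}
    (h : D.IsHighestWeightRep wt ρ v) (φ : Module.Dual ℂ V) : D.coordRingModU :=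
  ⟨fun g => φ (ρ g v), h.rational φ v, fun g u hu => by
    simp [map_mul, h.unipotent u hu]⟩

end CartanDecomposition

/-! ### Weighted lexicographic orders on `ℕ^N` -/

section Orders

variable {N : ℕ}

/-- `a <_lex b`. -/
def lexLT (a b : Fin N → ℕ) : Prop := ∃ i, (∀ j, j < i → a j = b j) ∧ a i < b i

/-- `a <_rlex b`. -/
def rlexLT (a b : Fin N → ℕ) : Prop := ∃ i, (∀ j, i < j → a j = b j) ∧ a i < b i

/-- The value of a linear map `ℤ^N → ℤ` at an element of `ℕ^N`. -/
def wtVal (Ψ : (Fin N → ℤ) →ₗ[ℤ] ℤ) (a : Fin N → ℕ) : ℤ := Ψ fun i => (a i : ℤ)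

/-- `lt` refines the weight order of `Ψ` by means of `r`. -/
def Refines (Ψ : (Fin N → ℤ) →ₗ[ℤ] ℤ) (r lt : (Fin N → ℕ) → (Fin N → ℕ) → Prop) : Prop :=
  ∀ a b, lt a b ↔ wtVal Ψ a < wtVal Ψ b ∨ (wtVal Ψ a = wtVal Ψ b ∧ r a b)

/-- `lt` is (the strict order `<` of) a `Ψ`-weighted lex order on `ℕ^N`, for some integral weight
function `Ψ`: a weighted lexicographic or right lexicographic order or, if `Ψ` is positive on
`ℕ^N - {0}`, a weighted opposite lexicographic or opposite right lexicographic order. -/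
def IsWeightedLexOrder (lt : (Fin N → ℕ) → (Fin N → ℕ) → Prop) : Prop :=
  ∃ Ψ : (Fin N → ℤ) →ₗ[ℤ] ℤ, (∀ a, 0 ≤ wtVal Ψ a) ∧
    (Refines Ψ lexLT lt ∨ Refines Ψ rlexLT lt ∨
      ((∀ a, a ≠ 0 → 0 < wtVal Ψ a) ∧
        (Refines Ψ (fun a b => lexLT b a) lt ∨ Refines Ψ (fun a b => rlexLT b a) lt)))

end Orders

/-! ### Essential multi-exponents -/

section Essential

variable {G : Subgroup (GLC n)} {D : CartanDecomposition G} {N : ℕ}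
  {V : Type*} [AddCommGroup V] [Module ℂ V] [FiniteDimensional ℂ V]

/-- The action on `V` of the monomial `f_{β₁}^{(m₁)} ⋯ f_{β_N}^{(m_N)}` in the divided powers
`f_β^{(m)} = f_β^m / m!`. -/
def monomialOp (f : D.RootVectors) (S : Fin N → D.pos) (ρ : Representation ℂ G V)
    (m : Fin N → ℕ) : Module.End ℂ V :=
  (List.ofFn fun i => ((Nat.factorial (m i) : ℂ)⁻¹ • dRep ρ (f.lie (S i)) ^ m i)).prod

/-- The filtration subspace `V_{< m}`, spanned by the `f^{(k)} v` with `k < m`. -/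
def filtLT (f : D.RootVectors) (S : Fin N → D.pos) (lt : (Fin N → ℕ) → (Fin N → ℕ) → Prop)
    (ρ : Representation ℂ G V) (v : V) (m : Fin N → ℕ) : Submodule ℂ V :=
  Submodule.span ℂ {w | ∃ k, lt k m ∧ w = monomialOp f S ρ k v}

/-- The filtration subspace `V_{≤ m}`, spanned by the `f^{(k)} v` with `k ≤ m`. -/
def filtLE (f : D.RootVectors) (S : Fin N → D.pos) (lt : (Fin N → ℕ) → (Fin N → ℕ) → Prop)
    (ρ : Representation ℂ G V) (v : V) (m : Fin N → ℕ) : Submodule ℂ V :=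
  Submodule.span ℂ {w | ∃ k, (lt k m ∨ k = m) ∧ w = monomialOp f S ρ k v}

/-- The set `es(V)` of essential multi-exponents: the `m` with `V_{≤ m} / V_{< m} ≠ 0`. -/
def es (f : D.RootVectors) (S : Fin N → D.pos) (lt : (Fin N → ℕ) → (Fin N → ℕ) → Prop)
    (ρ : Representation ℂ G V) (v : V) : Set (Fin N → ℕ) :=
  {m | filtLT f S lt ρ v m ≠ filtLE f S lt ρ v m}

/-- `B` is the basis of `V` that consists of the essential vectors `f^{(p)} v`, `p ∈ es(V)`. -/
def IsEssentialBasis (f : D.RootVectors) (S : Fin N → D.pos)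
    (lt : (Fin N → ℕ) → (Fin N → ℕ) → Prop) (ρ : Representation ℂ G V) (v : V)
    (B : Module.Basis (es f S lt ρ v) ℂ V) : Prop :=
  ∀ p : es f S lt ρ v, B p = monomialOp f S ρ p v

/-- The element `ξ_p` of `ℂ[G//U]`: the function given by the linear form dual to the basis
vector indexed by `p`. -/
def xi {f : D.RootVectors} {S : Fin N → D.pos} {lt : (Fin N → ℕ) → (Fin N → ℕ) → Prop}
    {ρ : Representation ℂ G V} {v : V} {wt : charLattice D.T}
    (h : D.IsHighestWeightRep wt ρ v) (B : Module.Basis (es f S lt ρ v) ℂ V)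
    (p : es f S lt ρ v) : D.coordRingModU :=
  h.toFun (B.coord p)

end Essential

end DualEssential

end

/-! A matrix coefficient `g ↦ ξ (g v)`, restricted to the products `exp (z₁ f_{β₁}) ⋯ exp (z_N
f_{β_N})`, is the polynomial `∑ z^m ξ (f^(m) v)`: root vectors are nilpotent, so every exponential
series is finite (`rep_prodElt`). For `ξ = ξ_p` the smallest monomial is `z^p`, with coefficient 1,
because `f^(m) v` is a combination of essential vectors with exponents at most `m`. For a monomial
order smallest terms multiply, so `ξ_p ξ_q` restricts to `z^(p+q)` plus larger terms
(`dual_monomialOp_mul`). If the product is the matrix coefficient of a form `ζ` on `V(λ+μ)`, then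
`ζ` kills `f^(m) v` for `m < p + q` and is 1 at `p + q`. Hence `p + q` is essential, and the
coefficients of `ζ` in the dual basis, namely its values `ζ (f^(r) v)`, give the expansion.

The form `ζ` comes from complete reducibility (`exists_dual_mul`): the `G`-span of `(v_λ ⊗ v_μ,
v_{λ+μ})` in `(V(λ) ⊗ V(μ)) × V(λ+μ)` projects injectively to the second factor, because its vectors
of highest weight form a line.

This fact, and the spanning of `V(λ)` by monomials, rest on `rep_mem_span_monomialOp`. The span of
`U⁻ x`, for `x` fixed by `U` and of some weight, is stable under `Lie G`, hence under `G`; dominance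
of the product map replaces `U⁻` by monomials. Two facts of structure theory are proved on the way.
A subspace stable under `Lie G` is stable under a connected `G` (`mem_of_dRep_mem`): its stabilizer
has the same functions as `G` near each of its points, by an Euler vector field and Krull's
intersection theorem, so connectedness gives equality. And the negative of a root is a root
(`isRoot_inv`), by solving `[X,[X,Y]] = X` in matrices and projecting to `Lie G`. -/

noncomputable section

namespace DualEssential

open MvPolynomial

variable {n : ℕ}

/-! ### Regular functions as polynomials -/

/-- Polynomials in the matrix entries and a further variable `none` for the inverse of the
determinant. -/
abbrev PolyRing (n : ℕ) := MvPolynomial (Option (Fin n × Fin n)) ℂ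

/-- The coordinates of an invertible matrix. -/
def pt (g : GLC n) : Option (Fin n × Fin n) → ℂ
  | none => (g : MatC n).det⁻¹
  | some ij => (g : MatC n) ij.1 ij.2

/-- Evaluation of a polynomial at an invertible matrix. -/
def ev (g : GLC n) : PolyRing n →ₐ[ℂ] ℂ := aeval (pt g)

@[simp] lemma ev_X_some (g : GLC n) (i j : Fin n) :
    ev g (X (some (i, j))) = (g : MatC n) i j := by simp [ev, pt]

@[simp] lemma ev_X_none (g : GLC n) : ev g (X none) = (g : MatC n).det⁻¹ := by simp [ev, pt]

lemma det_ne_zero (g : GLC n) : (g : MatC n).det ≠ 0 :=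
  ((Matrix.isUnit_iff_isUnit_det _).1 g.isUnit).ne_zero

/-- An algebra generated by functions is the range of evaluation. One polynomial ring thus serves
all subgroups at once, and ideals, derivations and the Nullstellensatz can be applied there. -/
lemma mem_coordRing_iff {H : Subgroup (GLC n)} {φ : H → ℂ} :
    φ ∈ coordRing H ↔ ∃ P : PolyRing n, ∀ h : H, φ h = ev (h : GLC n) P := by
  have key : coordRing H = (aeval (R := ℂ) fun (o : Option (Fin n × Fin n)) (h : H) =>
      pt (h : GLC n) o).range := by
    rw [← Algebra.adjoin_range_eq_range_aeval, coordRing]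
    congr 1
    ext φ
    constructor
    · rintro (⟨i, j, rfl⟩ | rfl)
      · exact ⟨some (i, j), rfl⟩
      · exact ⟨none, rfl⟩
    · rintro ⟨_ | ⟨i, j⟩, rfl⟩
      · exact Or.inr rfl
      · exact Or.inl ⟨i, j, rfl⟩
  have hev : ∀ (P : PolyRing n) (h : H), aeval (R := ℂ) (fun (o : Option (Fin n × Fin n)) (h : H) =>
      pt (h : GLC n) o) P h = ev (h : GLC n) P := by
    intro P h
    induction P using MvPolynomial.induction_on with
    | C a => simp [← algebraMap_eq]
    | add p q hp hq => rw [map_add, map_add, Pi.add_apply, hp, hq]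
    | mul_X p o hp => rw [map_mul, map_mul, Pi.mul_apply, hp, aeval_X, ev, aeval_X]
  rw [key]
  constructor
  · rintro ⟨P, rfl⟩
    exact ⟨P, hev P⟩
  · rintro ⟨P, hP⟩
    refine ⟨P, funext fun h => ?_⟩
    rw [hP h]
    exact hev P h

/-- The determinant as a polynomial in the matrix entries. -/
def detPoly (n : ℕ) : PolyRing n := (Matrix.of fun i j : Fin n => X (some (i, j))).det

@[simp] lemma ev_detPoly (g : GLC n) : ev g (detPoly n) = (g : MatC n).det := by
  rw [detPoly, AlgHom.map_det]
  congr 1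
  ext i j
  simp

/-- Left translation of polynomials. -/
def translate (g : GLC n) : PolyRing n →ₐ[ℂ] PolyRing n :=
  aeval fun o => match o with
    | none => C ((g : MatC n).det⁻¹) * X none
    | some ij => ∑ k, C ((g : MatC n) ij.1 k) * X (some (k, ij.2))

lemma ev_translate (g h : GLC n) (P : PolyRing n) : ev h (translate g P) = ev (g * h) P := by
  have : (ev h).comp (translate g) = ev (g * h) := by
    ext (_ | ⟨i, j⟩)
    · simp [translate, mul_comm, ← algebraMap_eq]
    · simp [translate, Matrix.mul_apply, ← algebraMap_eq]
  exact DFunLike.congr_fun this P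

/-! ### Left invariant derivations -/

lemma expGL_add (X : MatC n) (s t : ℂ) : expGL ((s + t) • X) = expGL (s • X) * expGL (t • X) := by
  ext1
  simp only [expGL, add_smul, Units.val_mul, IsUnit.unit_spec]
  exact Matrix.exp_add_of_commute _ _ (((Commute.refl X).smul_left s).smul_right t)

@[simp] lemma expGL_zero : expGL (0 : MatC n) = 1 := by
  ext1
  simp [expGL]

lemma expGL_conj (g : GLC n) (X : MatC n) :
    expGL ((g : MatC n) * X * ((g⁻¹ : GLC n) : MatC n)) = g * expGL X * g⁻¹ := by
  ext1
  simp only [expGL, Units.val_mul, IsUnit.unit_spec]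
  exact Matrix.exp_units_conj g X

lemma hasDerivAt_mul_expGL (g : GLC n) (Y : MatC n) (i j : Fin n) (s : ℂ) :
    HasDerivAt (fun s : ℂ => ((g * expGL (s • Y) : GLC n) : MatC n) i j)
      (∑ k, ((g * expGL (s • Y) : GLC n) : MatC n) i k * Y k j) s := by
  let : NormedRing (MatC n) := Matrix.linftyOpNormedRing
  let : NormedAlgebra ℂ (MatC n) := Matrix.linftyOpNormedAlgebra
  have h := hasDerivAt_exp_smul_const (𝕂 := ℂ) Y s
  have h2 := h.const_mul (g : MatC n)
  rw [← mul_assoc] at h2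
  have h3 := hasDerivAt_pi.1 (hasDerivAt_pi.1 h2 i) j
  rw [Matrix.mul_apply] at h3
  exact h3

/-- The derivation with `x ↦ x Y` on matrix entries, and `0` on the last variable. -/
def entryDer (Y : MatC n) : Derivation ℂ (PolyRing n) (PolyRing n) :=
  mkDerivation ℂ fun o => match o with
    | none => 0
    | some ij => ∑ k, C (Y k ij.2) * X (some (ij.1, k))

/-- The left invariant derivation attached to a matrix. -/
def leftDer (Y : MatC n) : Derivation ℂ (PolyRing n) (PolyRing n) :=
  mkDerivation ℂ fun o => match o with
    | none => - (X none ^ 2 * entryDer Y (detPoly n))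
    | some ij => ∑ k, C (Y k ij.2) * X (some (ij.1, k))

@[simp] lemma entryDer_some (Y : MatC n) (i j : Fin n) :
    entryDer Y (X (some (i, j))) = ∑ k, C (Y k j) * X (some (i, k)) := by simp [entryDer]

@[simp] lemma leftDer_some (Y : MatC n) (i j : Fin n) :
    leftDer Y (X (some (i, j))) = ∑ k, C (Y k j) * X (some (i, k)) := by simp [leftDer]

@[simp] lemma leftDer_none (Y : MatC n) :
    leftDer Y (X none) = - (X none ^ 2 * entryDer Y (detPoly n)) := by simp [leftDer]

/-- The polynomials in the matrix entries. -/
def entryRing (n : ℕ) : Subalgebra ℂ (PolyRing n) :=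
  Algebra.adjoin ℂ (Set.range fun ij : Fin n × Fin n => X (some ij))

lemma detPoly_mem_entryRing : detPoly n ∈ entryRing n := by
  rw [detPoly, Matrix.det_apply]
  refine sum_mem fun σ _ => Subalgebra.zsmul_mem _ ?_ _
  exact prod_mem fun i _ => Algebra.subset_adjoin ⟨(σ i, i), rfl⟩

/-- Polynomials in the entries come first: `leftDer` on the inverse determinant is defined through
the derivative of the determinant, which must be known beforehand. -/
lemma hasDerivAt_ev_entryDer (g : GLC n) (Y : MatC n) {P : PolyRing n} (hP : P ∈ entryRing n)
    (s : ℂ) : HasDerivAt (fun s : ℂ => ev (g * expGL (s • Y)) P)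
      (ev (g * expGL (s • Y)) (entryDer Y P)) s := by
  induction hP using Algebra.adjoin_induction with
  | mem x hx =>
    obtain ⟨⟨i, j⟩, rfl⟩ := hx
    simpa [mul_comm, AlgHom.commutes, ← algebraMap_eq] using hasDerivAt_mul_expGL g Y i j s
  | algebraMap r => simpa using hasDerivAt_const s r
  | add x y _ _ hx hy => simpa only [map_add] using! hx.add hy
  | mul x y _ _ hx hy =>
    have := hx.mul hy
    simp only [Derivation.leibniz, smul_eq_mul, map_add, map_mul]
    convert! this using 1
    ring

lemma hasDerivAt_ev (g : GLC n) (Y : MatC n) (P : PolyRing n) (s : ℂ) :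
    HasDerivAt (fun s : ℂ => ev (g * expGL (s • Y)) P)
      (ev (g * expGL (s • Y)) (leftDer Y P)) s := by
  induction P using MvPolynomial.induction_on with
  | C a => simpa [← algebraMap_eq] using hasDerivAt_const s a
  | add p q hp hq => simpa only [map_add] using! hp.add hq
  | mul_X p o hp =>
    have ho : HasDerivAt (fun s : ℂ => ev (g * expGL (s • Y)) (X o))
        (ev (g * expGL (s • Y)) (leftDer Y (X o))) s := by
      rcases o with _ | ⟨i, j⟩
      · have h := (hasDerivAt_ev_entryDer g Y detPoly_mem_entryRing s).inv
          (by simpa only [ev_detPoly] using det_ne_zero _)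
        simp only [ev_detPoly] at h
        simp only [ev_X_none, leftDer_none, map_neg, map_mul, map_pow]
        convert! h using 1
        field_simp
      · simpa [mul_comm, AlgHom.commutes, ← algebraMap_eq] using hasDerivAt_mul_expGL g Y i j s
    have := hp.mul ho
    simp only [Derivation.leibniz, smul_eq_mul, map_add, map_mul]
    convert! this using 1
    ring

lemma hasDerivAt_ev_zero (g : GLC n) (Y : MatC n) (P : PolyRing n) :
    HasDerivAt (fun s : ℂ => ev (g * expGL (s • Y)) P) (ev g (leftDer Y P)) 0 := by
  simpa using hasDerivAt_ev g Y P 0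

/-- `leftDer` is linear in the matrix. -/
def leftDerLin (P : PolyRing n) : MatC n →ₗ[ℂ] PolyRing n where
  toFun Y := leftDer Y P
  map_add' Y Z := by
    have h : entryDer (Y + Z) = entryDer Y + entryDer Z := by
      refine derivation_ext ?_
      rintro (_ | ⟨i, j⟩)
      · simp [entryDer]
      · simp [Finset.sum_add_distrib, add_mul]
    have : leftDer (Y + Z) = leftDer Y + leftDer Z := by
      refine derivation_ext ?_
      rintro (_ | ⟨i, j⟩)
      · simp [h]; ring
      · simp [Finset.sum_add_distrib, add_mul]
    simp [this]
  map_smul' a Y := by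
    have h : entryDer (a • Y) = a • entryDer Y := by
      refine derivation_ext ?_
      rintro (_ | ⟨i, j⟩)
      · simp [entryDer]
      · simp [Finset.smul_sum, MvPolynomial.smul_eq_C_mul, mul_assoc]
    have : leftDer (a • Y) = a • leftDer Y := by
      refine derivation_ext ?_
      rintro (_ | ⟨i, j⟩)
      · simp [h]
      · simp [Finset.smul_sum, MvPolynomial.smul_eq_C_mul, mul_assoc]
    simp [this]

@[simp] lemma leftDerLin_apply (P : PolyRing n) (Y : MatC n) : leftDerLin P Y = leftDer Y P := rfl

/-! ### Entire functions along one-parameter groups -/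

/-- An entire function is the sum of its Taylor series at 0. -/
lemma eq_zero_of_iterated_derivs {F : ℕ → ℂ → ℂ} (hF : ∀ k s, HasDerivAt (F k) (F (k + 1) s) s)
    (h0 : ∀ k, F k 0 = 0) (s : ℂ) : F 0 s = 0 := by
  have hit : ∀ k, iteratedDeriv k (F 0) = F k := by
    intro k
    induction k with
    | zero => simp
    | succ k ih =>
      rw [iteratedDeriv_succ, ih]
      exact funext fun s => (hF k s).deriv
  have hd : Differentiable ℂ (F 0) := fun s => (hF 0 s).differentiableAt
  rw [← Complex.taylorSeries_eq_of_entire' 0 s hd]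
  simp [hit, h0]

/-- The polynomials that vanish on `H`. -/
def vanishing (H : Set (GLC n)) : Ideal (PolyRing n) where
  carrier := {P | ∀ g ∈ H, ev g P = 0}
  add_mem' ha hb g hg := by simp [ha g hg, hb g hg]
  zero_mem' g _ := by simp
  smul_mem' c P hP g hg := by simp [hP g hg]

lemma mem_vanishing {H : Set (GLC n)} {P : PolyRing n} :
    P ∈ vanishing H ↔ ∀ g ∈ H, ev g P = 0 := Iff.rfl

lemma IsZariskiClosed.mem_of_vanishing {H : Subgroup (GLC n)} (hH : IsZariskiClosed H) {g : GLC n}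
    (h : ∀ P ∈ vanishing (H : Set (GLC n)), ev g P = 0) : g ∈ H := by
  obtain ⟨I, hI⟩ := hH
  have hr : ∀ (P : MvPolynomial (Fin n × Fin n) ℂ) (g : GLC n), ev g (rename some P) =
      MvPolynomial.eval (fun ij => (g : MatC n) ij.1 ij.2) P := by
    intro P g
    rw [ev, aeval_rename]
    rfl
  rw [hI]
  intro P hP
  rw [← hr]
  exact h _ fun g hg => by rw [hr]; exact (hI g).1 hg P hP

/-- A matrix lies in the Lie algebra of `G` as soon as the derivatives at `1` along it of all
polynomials that vanish on `G` are zero. -/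
lemma mem_lieAlg_of_deriv_one {G : Subgroup (GLC n)} (hG : IsZariskiClosed G) {Y : MatC n}
    (h : ∀ P ∈ vanishing (G : Set (GLC n)), ev 1 (leftDer Y P) = 0) : Y ∈ lieAlg G := by
  -- Left translation by `g ∈ G` preserves the ideal of `G` and commutes with the left invariant
  -- derivation; this carries the hypothesis from 1 to `g`.
  have hst : ∀ P ∈ vanishing (G : Set (GLC n)), leftDer Y P ∈ vanishing (G : Set (GLC n)) := by
    intro P hP g hg
    have h1 := h (translate g P) fun x hx => by
      rw [ev_translate]; exact hP _ (G.mul_mem hg hx)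
    have h2 := hasDerivAt_ev_zero 1 Y (translate g P)
    simp only [ev_translate, one_mul] at h2
    rw [← h1]
    exact (hasDerivAt_ev_zero g Y P).unique h2
  intro s
  refine hG.mem_of_vanishing fun P hP => ?_
  have hk : ∀ k : ℕ, (leftDer Y)^[k] P ∈ vanishing (G : Set (GLC n)) := by
    intro k
    induction k with
    | zero => exact hP
    | succ k ih => rw [Function.iterate_succ_apply']; exact hst _ ih
  have := eq_zero_of_iterated_derivs (F := fun k s => ev (1 * expGL (s • Y)) ((leftDer Y)^[k] P))
    (fun k s => by
      rw [Function.iterate_succ_apply']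
      exact hasDerivAt_ev 1 Y _ s) (fun k => by simpa using hk k 1 G.one_mem) s
  simpa using this

lemma ev_leftDer_eq_zero {H : Set (GLC n)} {Y : MatC n} {P : PolyRing n} (hP : P ∈ vanishing H)
    {g : GLC n} (hg : ∀ s : ℂ, g * expGL (s • Y) ∈ H) : ev g (leftDer Y P) = 0 := by
  have h : HasDerivAt (fun s : ℂ => ev (g * expGL (s • Y)) P) 0 0 :=
    (hasDerivAt_const (0 : ℂ) (0 : ℂ)).congr_of_eventuallyEq
      (Filter.Eventually.of_forall fun s => mem_vanishing.1 hP _ (hg s))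
  exact (hasDerivAt_ev_zero g Y P).unique h

/-- The Lie algebra of a closed subgroup, as a subspace of the matrices. -/
def lieSub (G : Subgroup (GLC n)) (hG : IsZariskiClosed G) : Submodule ℂ (MatC n) where
  carrier := lieAlg G
  -- `exp (X + Y)` is not `exp X exp Y` in general, but the tangent condition at 1 is linear in the
  -- matrix.
  add_mem' {X Y} hX hY := mem_lieAlg_of_deriv_one hG fun P hP => by
    have h1 := ev_leftDer_eq_zero hP (g := 1) (Y := X) fun s => by simpa using hX s
    have h2 := ev_leftDer_eq_zero hP (g := 1) (Y := Y) fun s => by simpa using hY s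
    rw [← leftDerLin_apply, map_add, map_add, leftDerLin_apply, leftDerLin_apply, h1, h2, add_zero]
  zero_mem' s := by simp [G.one_mem]
  smul_mem' a X hX s := by
    rw [smul_smul]
    exact hX _

lemma conj_mem_lieAlg {G : Subgroup (GLC n)} {g : GLC n} (hg : g ∈ G) {X : MatC n}
    (hX : X ∈ lieAlg G) : (g : MatC n) * X * ((g⁻¹ : GLC n) : MatC n) ∈ lieAlg G := by
  intro s
  have : s • ((g : MatC n) * X * ((g⁻¹ : GLC n) : MatC n)) =
      (g : MatC n) * (s • X) * ((g⁻¹ : GLC n) : MatC n) := by simp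
  rw [this, expGL_conj]
  exact G.mul_mem (G.mul_mem hg (hX s)) (G.inv_mem hg)

/-! ### Closed subgroups with the same Lie algebra as a connected group -/

/-- The entry `(i, j)` as a polynomial that vanishes at `1`. -/
def entrySub (ij : Fin n × Fin n) : PolyRing n :=
  X (some ij) - C ((1 : MatC n) ij.1 ij.2)

lemma entrySub_mem (ij : Fin n × Fin n) : entrySub ij ∈ vanishing ({1} : Set (GLC n)) := by
  obtain ⟨i, j⟩ := ij
  rintro g rfl
  simp [entrySub, ← algebraMap_eq]

lemma ev_leftDer_entrySub (Y : MatC n) (ij : Fin n × Fin n) :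
    ev 1 (leftDer Y (entrySub ij)) = Y ij.1 ij.2 := by
  obtain ⟨i, j⟩ := ij
  rw [entrySub, map_sub, ← algebraMap_eq, Derivation.map_algebraMap, sub_zero, leftDer_some]
  simp [← algebraMap_eq, Matrix.one_apply]

lemma vanishing_mono {A B : Set (GLC n)} (h : A ⊆ B) : vanishing B ≤ vanishing A :=
  fun _ hP g hg => hP g (h hg)

lemma sub_ev_mem (P : PolyRing n) : P - C (ev 1 P) ∈ vanishing ({1} : Set (GLC n)) := by
  rintro g rfl
  simp [← algebraMap_eq]

/-- The cotangent space of `G` at `1` is the dual of the Lie algebra of `G`. -/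
lemma mem_sq_sup_vanishing {G : Subgroup (GLC n)} (hG : IsZariskiClosed G) {y : PolyRing n}
    (hy : y ∈ vanishing ({1} : Set (GLC n))) (h : ∀ Y ∈ lieAlg G, ev 1 (leftDer Y y) = 0) :
    y ∈ vanishing ({1} : Set (GLC n)) ^ 2 ⊔ vanishing (G : Set (GLC n)) := by
  set m := vanishing ({1} : Set (GLC n)) with hm
  set J := vanishing (G : Set (GLC n)) with hJ
  by_contra hcon
  obtain ⟨δ, hδy, hδ⟩ := Submodule.exists_le_ker_of_notMem
    (p := (m ^ 2 ⊔ J).restrictScalars ℂ) (v := y) (by exact hcon)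
  have hδ0 : ∀ P ∈ m ^ 2 ⊔ J, δ P = 0 := fun P hP => hδ (by exact hP)
  -- Since `δ` kills `m²`, the map `d` satisfies the Leibniz rule at 1. It is therefore the
  -- derivative along the matrix `Y` of its values on the entries, and `Y ∈ Lie G` because `d` kills
  -- `J`.
  let d : PolyRing n → ℂ := fun P => δ (P - C (ev 1 P))
  have dadd : ∀ P Q, d (P + Q) = d P + d Q := fun P Q => by
    simp only [d, ← map_add]
    congr 1
    simp only [map_add]
    ring
  have dC : ∀ a, d (C a) = 0 := fun a => by simp [d, ← algebraMap_eq]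
  have dmul : ∀ P Q, d (P * Q) = ev 1 P * d Q + ev 1 Q * d P := fun P Q => by
    have e : P * Q - C (ev 1 (P * Q)) = (P - C (ev 1 P)) * (Q - C (ev 1 Q)) +
        (ev 1 P • (Q - C (ev 1 Q)) + ev 1 Q • (P - C (ev 1 P))) := by
      simp only [smul_eq_C_mul, map_mul]
      ring
    simp only [d]
    rw [e, map_add, hδ0, map_add, map_smul, map_smul]
    · simp
    · exact Ideal.mem_sup_left (by rw [sq]; exact Ideal.mul_mem_mul (sub_ev_mem P) (sub_ev_mem Q))
  have dJ : ∀ P ∈ J, d P = 0 := fun P hP => by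
    have : ev 1 P = 0 := hP 1 G.one_mem
    simp only [d, this, map_zero, sub_zero]
    exact hδ0 P (Ideal.mem_sup_right hP)
  let Y : MatC n := Matrix.of fun i j => d (X (some (i, j)))
  have hsome : ∀ i j, ev 1 (∑ k, C (Y k j) * X (some (i, k))) = d (X (some (i, j))) := by
    intro i j
    simp [← algebraMap_eq, Matrix.one_apply, Y]
  have h1 : ∀ P ∈ entryRing n, d P = ev 1 (entryDer Y P) := by
    intro P hP
    induction hP using Algebra.adjoin_induction with
    | mem x hx =>
      obtain ⟨⟨i, j⟩, rfl⟩ := hx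
      rw [entryDer_some, hsome]
    | algebraMap r => rw [algebraMap_eq, dC, ← algebraMap_eq, Derivation.map_algebraMap, map_zero]
    | add x y _ _ hx hy => rw [dadd, hx, hy, map_add, map_add]
    | mul x y _ _ hx hy => simp [dmul, hx, hy]
  -- The value on the inverse determinant is forced by the relation `X none * detPoly n = 1`, which
  -- holds modulo `J`.
  have hnone : d (X none) = ev 1 (leftDer Y (X none)) := by
    have h2 : X none * detPoly n - C 1 ∈ J := by
      intro g _
      simp [det_ne_zero g]
    have h3 := dadd (X none * detPoly n - C 1) (C 1)
    rw [sub_add_cancel, dC, dJ _ h2, dmul, h1 _ detPoly_mem_entryRing] at h3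
    simp only [ev_X_none, ev_detPoly, Units.val_one, Matrix.det_one, inv_one, one_mul,
      add_zero] at h3
    simp only [leftDer_none, map_neg, map_mul, map_pow, ev_X_none, Units.val_one, Matrix.det_one,
      inv_one, one_mul, one_pow]
    linear_combination h3
  have hall : ∀ P, d P = ev 1 (leftDer Y P) := by
    intro P
    induction P using MvPolynomial.induction_on with
    | C a => rw [dC, ← algebraMap_eq, Derivation.map_algebraMap, map_zero]
    | add p q hp hq => rw [dadd, hp, hq, map_add, map_add]
    | mul_X p o hp =>
      have ho : d (X o) = ev 1 (leftDer Y (X o)) := by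
        rcases o with _ | ⟨i, j⟩
        · exact hnone
        · rw [leftDer_some, hsome]
      simp [dmul, hp, ho]
  have hY : Y ∈ lieAlg G := mem_lieAlg_of_deriv_one hG fun P hP => by rw [← hall, dJ P hP]
  have hy0 : ev 1 y = 0 := hy 1 rfl
  apply hδy
  have := hall y
  rw [h Y hY] at this
  simpa [d, hy0] using this

/-! ### The Euler vector field and vanishing to infinite order at the identity. -/

section Euler

variable {G : Subgroup (GLC n)} (hG : IsZariskiClosed G) (π : MatC n →ₗ[ℂ] lieSub G hG)

/-- The Euler vector field at `1`. -/
def euler : Derivation ℂ (PolyRing n) (PolyRing n) :=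
  ∑ ij : Fin n × Fin n, entrySub ij • leftDer (π (Matrix.single ij.1 ij.2 1) : MatC n)

lemma euler_apply (P : PolyRing n) : euler hG π P =
    ∑ ij : Fin n × Fin n, entrySub ij * leftDer (π (Matrix.single ij.1 ij.2 1) : MatC n) P := by
  have := congrFun (map_sum (Derivation.coeFnAddMonoidHom (R := ℂ) (A := PolyRing n)
    (M := PolyRing n)) (fun ij : Fin n × Fin n => entrySub ij •
      leftDer (π (Matrix.single ij.1 ij.2 1) : MatC n)) Finset.univ) P
  rw [Finset.sum_apply] at this
  exact this

lemma euler_mem {I : Ideal (PolyRing n)} {P : PolyRing n}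
    (h : ∀ Y ∈ lieAlg G, leftDer Y P ∈ I) :
    euler hG π P ∈ vanishing ({1} : Set (GLC n)) * I := by
  rw [euler_apply]
  exact Ideal.sum_mem _ fun ij _ => Ideal.mul_mem_mul (entrySub_mem ij) (h _ (π _).2)

/-- The Euler field induces the identity on the cotangent space of `G` at 1. Modulo `m²` it sends
`y` to the linear form `y'` in the `entrySub` whose coefficients are the derivatives of `y` along
the projected matrix units; `y'` and `y` have the same differential on `Lie G`, so
`mem_sq_sup_vanishing` applies. -/
lemma euler_sub_mem (hπ : ∀ Y : lieSub G hG, π Y = Y) {y : PolyRing n}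
    (hy : y ∈ vanishing ({1} : Set (GLC n))) :
    euler hG π y - y ∈ vanishing ({1} : Set (GLC n)) ^ 2 ⊔ vanishing (G : Set (GLC n)) := by
  let D : Fin n × Fin n → PolyRing n := fun ij =>
    leftDer (π (Matrix.single ij.1 ij.2 1) : MatC n) y
  let y' : PolyRing n := ∑ ij : Fin n × Fin n, ev 1 (D ij) • entrySub ij
  have h1 : euler hG π y - y' ∈ vanishing ({1} : Set (GLC n)) ^ 2 := by
    rw [euler_apply, ← Finset.sum_sub_distrib, sq]
    refine Ideal.sum_mem _ fun ij _ => ?_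
    rw [smul_eq_C_mul, mul_comm (C _), ← mul_sub]
    exact Ideal.mul_mem_mul (entrySub_mem ij) (sub_ev_mem _)
  have h2 : y' - y ∈ vanishing ({1} : Set (GLC n)) ^ 2 ⊔ vanishing (G : Set (GLC n)) := by
    refine mem_sq_sup_vanishing hG (Ideal.sub_mem _ (Ideal.sum_mem _ fun ij _ => ?_) hy) ?_
    · rw [smul_eq_C_mul]
      exact Ideal.mul_mem_left _ _ (entrySub_mem ij)
    · intro Y hY
      have e1 : leftDer Y y = ∑ ij : Fin n × Fin n, Y ij.1 ij.2 • D ij := by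
        have : Y = (π Y : MatC n) := (congrArg Subtype.val (hπ ⟨Y, hY⟩)).symm
        conv_lhs => rw [this, Matrix.matrix_eq_sum_single Y]
        rw [← Finset.sum_product' Finset.univ Finset.univ
          (fun i j => Matrix.single i j (Y i j)), ← leftDerLin_apply]
        rw [map_sum, Submodule.coe_sum, map_sum]
        refine Finset.sum_congr rfl fun ij _ => ?_
        have : Matrix.single ij.1 ij.2 (Y ij.1 ij.2) =
            Y ij.1 ij.2 • Matrix.single ij.1 ij.2 (1 : ℂ) := by simp
        rw [this, map_smul, Submodule.coe_smul, map_smul]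
        rfl
      rw [map_sub, map_sub, e1, map_sum, map_sum, map_sum, sub_eq_zero]
      refine Finset.sum_congr rfl fun ij _ => ?_
      rw [Derivation.map_smul, map_smul, map_smul, ev_leftDer_entrySub, smul_eq_mul, smul_eq_mul, mul_comm]
  have := Ideal.add_mem _ (Ideal.mem_sup_left h1) h2
  simpa using this

/-- Euler's identity for homogeneous functions: by the Leibniz rule, the eigenvalue 1 in degree one
becomes `k` in degree `k`. -/
lemma euler_sub_natCast_mul_mem (hπ : ∀ Y : lieSub G hG, π Y = Y) (k : ℕ) {y : PolyRing n}
    (hy : y ∈ vanishing ({1} : Set (GLC n)) ^ k) :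
    euler hG π y - k * y ∈
      vanishing ({1} : Set (GLC n)) ^ (k + 1) ⊔ vanishing (G : Set (GLC n)) := by
  induction k generalizing y with
  | zero =>
    refine Ideal.mem_sup_left ?_
    have := euler_mem hG π (I := ⊤) (P := y) fun _ _ => Submodule.mem_top
    simpa using this
  | succ k ih =>
    rw [pow_succ] at hy
    induction hy using Submodule.mul_induction_on' with
    | mem_mul_mem a ha b hb =>
      have e : euler hG π (a * b) - ((k + 1 : ℕ) : PolyRing n) * (a * b) =
          a * (euler hG π b - b) + b * (euler hG π a - k * a) := by
        simp only [Derivation.leibniz, smul_eq_mul]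
        push_cast
        ring
      rw [e]
      have hle : vanishing ({1} : Set (GLC n)) ^ k *
          (vanishing ({1} : Set (GLC n)) ^ 2 ⊔ vanishing (G : Set (GLC n))) ≤
          vanishing ({1} : Set (GLC n)) ^ (k + 1 + 1) ⊔ vanishing (G : Set (GLC n)) := by
        rw [Ideal.mul_sup, ← pow_add]
        exact sup_le_sup_left Ideal.mul_le_right _
      have hle2 : vanishing ({1} : Set (GLC n)) *
          (vanishing ({1} : Set (GLC n)) ^ (k + 1) ⊔ vanishing (G : Set (GLC n))) ≤
          vanishing ({1} : Set (GLC n)) ^ (k + 1 + 1) ⊔ vanishing (G : Set (GLC n)) := by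
        rw [Ideal.mul_sup, ← pow_succ']
        exact sup_le_sup_left Ideal.mul_le_right _
      exact Ideal.add_mem _ (hle (Ideal.mul_mem_mul ha (euler_sub_mem hG π hπ hb)))
        (hle2 (Ideal.mul_mem_mul hb (ih ha)))
    | add x _ y _ hx hy =>
      have := Ideal.add_mem _ hx hy
      convert! this using 1
      rw [map_add]
      ring

/-- An ideal stable under the derivations from `Lie G`, all of whose elements vanish at `1`,
consists of functions that vanish at `1` to infinite order. -/
lemma le_vanishing_sup_pow (hG : IsZariskiClosed G) {I : Ideal (PolyRing n)} (hI1 : I ≤ vanishing ({1} : Set (GLC n)))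
    (hI : ∀ P ∈ I, ∀ Y ∈ lieAlg G, leftDer Y P ∈ I) (k : ℕ) :
    I ≤ vanishing ({1} : Set (GLC n)) ^ k ⊔ vanishing (G : Set (GLC n)) := by
  obtain ⟨π, hπ⟩ := (lieSub G hG).subtype.exists_leftInverse_of_injective
    (Submodule.ker_subtype _)
  replace hπ : ∀ Y : lieSub G hG, π Y = Y := fun Y => DFunLike.congr_fun hπ Y
  have hJ1 : vanishing (G : Set (GLC n)) ≤ vanishing ({1} : Set (GLC n)) :=
    vanishing_mono (by simp [G.one_mem])
  induction k with
  | zero => simp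
  | succ k ih =>
    -- The inductive step divides by `k`; the passage from 0 to 1 is `hI1`.
    rcases Nat.eq_zero_or_pos k with rfl | hk
    · simpa using le_sup_of_le_left hI1
    intro P hP
    obtain ⟨μ, hμ, j, hj, rfl⟩ := Submodule.mem_sup.1 (ih hP)
    -- The derivatives of `μ + j` stay in `I`, so the Euler field raises its order of vanishing by
    -- one. But it multiplies `μ` by `k` modulo `m^(k+1)`; hence `k μ`, and so `μ`, already has the
    -- higher order.
    have h1 : euler hG π (μ + j) ∈
        vanishing ({1} : Set (GLC n)) ^ (k + 1) ⊔ vanishing (G : Set (GLC n)) := by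
      have := euler_mem hG π fun Y hY => ih (hI _ hP Y hY)
      rw [Ideal.mul_sup, ← pow_succ'] at this
      have hle : vanishing ({1} : Set (GLC n)) ^ (k + 1) ⊔
          vanishing ({1} : Set (GLC n)) * vanishing (G : Set (GLC n)) ≤
          vanishing ({1} : Set (GLC n)) ^ (k + 1) ⊔ vanishing (G : Set (GLC n)) :=
        sup_le_sup_left Ideal.mul_le_right _
      exact hle this
    have h2 : euler hG π j ∈
        vanishing ({1} : Set (GLC n)) ^ (k + 1) ⊔ vanishing (G : Set (GLC n)) := by
      refine Ideal.mem_sup_right (Ideal.mul_le_right (euler_mem hG π fun Y hY g hg => ?_))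
      exact ev_leftDer_eq_zero hj fun s => G.mul_mem hg (hY s)
    have h3 := euler_sub_natCast_mul_mem hG π hπ k hμ
    have h4 : (k : PolyRing n) * μ ∈
        vanishing ({1} : Set (GLC n)) ^ (k + 1) ⊔ vanishing (G : Set (GLC n)) := by
      have := Ideal.sub_mem _ (Ideal.sub_mem _ h1 h2) h3
      convert! this using 1
      rw [map_add]
      ring
    have h5 := Ideal.mul_mem_left _ (C ((k : ℂ)⁻¹)) h4
    rw [← mul_assoc, ← map_natCast (C : ℂ →+* PolyRing n) k, ← map_mul,
      inv_mul_cancel₀ (by exact_mod_cast hk.ne'), map_one, one_mul] at h5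
    exact Ideal.add_mem _ h5 (Ideal.mem_sup_right hj)

end Euler

/-- The relation between the last variable and the determinant lies in the ideal, so a zero is the
coordinate vector of an invertible matrix. -/
lemma eq_pt_of_mem_zeroLocus {G : Subgroup (GLC n)} (hG : IsZariskiClosed G)
    {x : Option (Fin n × Fin n) → ℂ} (hx : x ∈ zeroLocus ℂ (vanishing (G : Set (GLC n)))) :
    ∃ g ∈ G, x = pt g := by
  let A : MatC n := Matrix.of fun i j => x (some (i, j))
  have hdet : aeval (R := ℂ) x (detPoly n) = A.det := by
    rw [detPoly, AlgHom.map_det]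
    congr 1
    ext i j
    simp [A]
  have h1 : x none * A.det = 1 := by
    have := hx (X none * detPoly n - 1) fun g _ => by simp [det_ne_zero g]
    rwa [map_sub, map_mul, hdet, aeval_X, map_one, sub_eq_zero] at this
  let g : GLC n := Matrix.GeneralLinearGroup.mkOfDetNeZero A (right_ne_zero_of_mul_eq_one h1)
  have hgA : (g : MatC n) = A := rfl
  have hxg : x = pt g := by
    funext o
    rcases o with _ | ⟨i, j⟩
    · simp only [pt, hgA]
      exact eq_inv_of_mul_eq_one_left h1
    · rfl
  exact ⟨g, hG.mem_of_vanishing fun P hP => by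
    have := hx P hP
    rw [hxg] at this
    exact this, hxg⟩

/-- Near a point of `H` the functions vanishing on `H` vanish on `G`. After translation to 1 they
vanish there to infinite order on `G`, and Krull's intersection theorem gives a multiplier `1 - r`
with `r` zero at 1. -/
lemma exists_mul_mem_vanishing {G H : Subgroup (GLC n)} (hG : IsZariskiClosed G) (hHG : H ≤ G)
    (hexp : ∀ Y ∈ lieAlg G, ∀ s : ℂ, expGL (s • Y) ∈ H) {h : GLC n} (hh : h ∈ H)
    {P : PolyRing n} (hP : P ∈ vanishing (H : Set (GLC n))) :
    ∃ s, ev h s ≠ 0 ∧ s * P ∈ vanishing (G : Set (GLC n)) := by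
  have one : ∀ P ∈ vanishing (H : Set (GLC n)),
      ∃ s, ev 1 s ≠ 0 ∧ s * P ∈ vanishing (G : Set (GLC n)) := by
    intro P hP
    let J := vanishing (G : Set (GLC n))
    let m := vanishing ({1} : Set (GLC n))
    have hmem : (Ideal.Quotient.mk J P : PolyRing n ⧸ J) ∈
        (⨅ i : ℕ, m ^ i • ⊤ : Submodule (PolyRing n) (PolyRing n ⧸ J)) := by
      rw [Submodule.mem_iInf]
      intro k
      obtain ⟨μ, hμ, j, hj, rfl⟩ := Submodule.mem_sup.1 (le_vanishing_sup_pow hG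
        (I := vanishing (H : Set (GLC n))) (vanishing_mono (Set.singleton_subset_iff.2 H.one_mem))
        (fun Q hQ Y hY g hg => ev_leftDer_eq_zero hQ fun s => H.mul_mem hg (hexp Y hY s)) k hP)
      have : (Ideal.Quotient.mk J (μ + j) : PolyRing n ⧸ J) =
          μ • (Ideal.Quotient.mk J 1 : PolyRing n ⧸ J) := by
        rw [map_add, Ideal.Quotient.eq_zero_iff_mem.2 hj, add_zero, map_one]
        exact (mul_one _).symm
      rw [this]
      exact Submodule.smul_mem_smul hμ Submodule.mem_top
    obtain ⟨r, hr⟩ := (Ideal.mem_iInf_smul_pow_eq_bot_iff m _).1 hmem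
    refine ⟨1 - r, ?_, ?_⟩
    · have : ev 1 (r : PolyRing n) = 0 := r.2 1 rfl
      simp [this]
    · rw [← Ideal.Quotient.eq_zero_iff_mem, sub_mul, one_mul, map_sub, sub_eq_zero]
      exact hr.symm
  obtain ⟨s, hs1, hs⟩ := one (translate h P) fun g hg => by
    rw [ev_translate]
    exact hP _ (H.mul_mem hh hg)
  refine ⟨translate h⁻¹ s, by simpa [ev_translate] using hs1, fun g hg => ?_⟩
  have := hs (h⁻¹ * g) (G.mul_mem (G.inv_mem (hHG hh)) hg)
  rw [map_mul, ev_translate, mul_inv_cancel_left] at this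
  rw [map_mul, ev_translate, this]

/-- The ideal of `H` is finitely generated, and the product of the multipliers of its generators
works for all of it. -/
lemma exists_separator_colon {G H : Subgroup (GLC n)} (hG : IsZariskiClosed G) (hHG : H ≤ G)
    (hexp : ∀ Y ∈ lieAlg G, ∀ s : ℂ, expGL (s • Y) ∈ H) {h : GLC n} (hh : h ∈ H) :
    ∃ s, ev h s ≠ 0 ∧ ∀ P ∈ vanishing (H : Set (GLC n)), s * P ∈ vanishing (G : Set (GLC n)) := by
  obtain ⟨F, hF⟩ := IsNoetherian.noetherian (vanishing (H : Set (GLC n)))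
  have hFm : ∀ P : F, (P : PolyRing n) ∈ vanishing (H : Set (GLC n)) := fun P => by
    rw [← hF]; exact Submodule.subset_span P.2
  choose s hs1 hs2 using fun P : F => exists_mul_mem_vanishing hG hHG hexp hh (hFm P)
  refine ⟨∏ P : F, s P, ?_, fun P hP => ?_⟩
  · rw [map_prod]
    exact Finset.prod_ne_zero_iff.2 fun P _ => hs1 P
  · rw [← hF] at hP
    induction hP using Submodule.span_induction with
    | mem x hx =>
      obtain ⟨c, hc⟩ := Finset.dvd_prod_of_mem s (Finset.mem_univ (⟨x, hx⟩ : F))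
      rw [hc, mul_right_comm]
      exact Ideal.mul_mem_right _ _ (hs2 ⟨x, hx⟩)
    | zero => simp
    | add x y _ _ hx hy => rw [mul_add]; exact Ideal.add_mem _ hx hy
    | smul a x _ hx => rw [smul_eq_mul, mul_left_comm]; exact Ideal.mul_mem_left _ _ hx

/-- The basic open set of an idempotent is clopen, so it is empty or everything; the kernel of
evaluation at 1 is a point outside it. -/
lemma IsZariskiConnected.idempotent_eq_zero {G : Subgroup (GLC n)} (hc : IsZariskiConnected G)
    {e : G → ℂ} (he : e ∈ coordRing G) (hid : ∀ g, e g * e g = e g) (h1 : e 1 = 0) : e = 0 := by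
  let e' : coordRing G := ⟨e, he⟩
  have hmul : e' * (1 - e') = 0 := by
    ext g
    change e g * (1 - e g) = 0
    linear_combination - hid g
  have hcl : IsClopen (PrimeSpectrum.basicOpen e' : Set (PrimeSpectrum (coordRing G))) :=
    PrimeSpectrum.isClopen_iff_mul_add.2 ⟨e', 1 - e', hmul, by ring, rfl⟩
  have : PreconnectedSpace (PrimeSpectrum (coordRing G)) := hc.toPreconnectedSpace
  rcases isClopen_iff.1 hcl with h | h
  · have h2 : IsNilpotent e' := by
      rw [← PrimeSpectrum.basicOpen_eq_bot_iff]
      exact TopologicalSpace.Opens.ext h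
    obtain ⟨k, hk⟩ := h2
    funext g
    have : e g ^ k = 0 := congrFun (congrArg Subtype.val hk) g
    by_contra hg
    exact pow_ne_zero k hg this
  · exfalso
    let ψ : coordRing G →+* ℂ := (Pi.evalRingHom (fun _ : G => ℂ) 1).comp (coordRing G).val
    let p : PrimeSpectrum (coordRing G) := ⟨RingHom.ker ψ, RingHom.ker_isPrime ψ⟩
    have hp : p ∈ (PrimeSpectrum.basicOpen e' : Set (PrimeSpectrum (coordRing G))) := by
      rw [h]; trivial
    exact hp (RingHom.mem_ker.2 h1)

/-- A subgroup of a connected group `G` which is cut out by regular functions and contains the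
one-parameter groups of `G` is equal to `G`. -/
theorem le_of_expGL_mem {G H : Subgroup (GLC n)} (hG : IsZariskiClosed G)
    (hc : IsZariskiConnected G) (hHG : H ≤ G)
    (hexp : ∀ Y ∈ lieAlg G, ∀ s : ℂ, expGL (s • Y) ∈ H)
    (hsep : ∀ g ∈ G, g ∉ H → ∃ P ∈ vanishing (H : Set (GLC n)), ev g P ≠ 0) : G ≤ H := by
  let I := vanishing (H : Set (GLC n))
  let J := vanishing (G : Set (GLC n))
  let K : Ideal (PolyRing n) := J.colon (I : Set (PolyRing n))
  -- By the Nullstellensatz it is enough that `I` and `K` have no common zero. Such a zero is a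
  -- point of `G`; inside `H` an element of the colon ideal `K` is nonzero there, outside `H` an
  -- element of `I` is, by `hsep`.
  have htop : I ⊔ K = ⊤ := by
    rw [← Ideal.radical_eq_top, ← vanishingIdeal_zeroLocus_eq_radical (K := ℂ)]
    suffices zeroLocus ℂ (I ⊔ K) = ∅ by rw [this, vanishingIdeal_empty]
    rw [Set.eq_empty_iff_forall_notMem]
    intro x hx
    have hxI : ∀ P ∈ I, aeval x P = 0 := fun P hP => hx P (Ideal.mem_sup_left hP)
    have hxK : ∀ P ∈ K, aeval x P = 0 := fun P hP => hx P (Ideal.mem_sup_right hP)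
    obtain ⟨g, hg, rfl⟩ := eq_pt_of_mem_zeroLocus hG (x := x)
      fun P hP => hxI P (vanishing_mono hHG hP)
    by_cases hgH : g ∈ H
    · obtain ⟨s, hs, hsK⟩ := exists_separator_colon hG hHG hexp hgH
      exact hs (hxK s (Submodule.mem_colon.2 hsK))
    · obtain ⟨P, hP, hPg⟩ := hsep g hg hgH
      exact hPg (hxI P hP)
  -- Since `a * i` vanishes on `G`, the function `i` is idempotent on `G`. It is zero at 1, hence
  -- zero, so `a` is 1 on `G` and every function vanishing on `H` vanishes on `G`.
  obtain ⟨i, hi, a, ha, hia⟩ := Submodule.mem_sup.1 (htop ▸ Submodule.mem_top : (1 : PolyRing n) ∈ _)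
  replace ha : ∀ P ∈ I, a * P ∈ J := Submodule.mem_colon.1 ha
  have hev : ∀ g, ev g i + ev g a = 1 := fun g => by rw [← map_add, hia, map_one]
  have he := hc.idempotent_eq_zero (e := fun g => ev (g : GLC n) i)
    (mem_coordRing_iff.2 ⟨i, fun _ => rfl⟩) (fun g => by
      have h1 : ev (g : GLC n) (a * i) = 0 := ha i hi g g.2
      rw [map_mul] at h1
      linear_combination ev (g : GLC n) i * hev g - h1) (hi 1 H.one_mem)
  intro g hg
  by_contra hgH
  obtain ⟨P, hP, hPg⟩ := hsep g hg hgH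
  have h1 : ev g (a * P) = 0 := ha P hP g hg
  have h2 : ev g i = 0 := congrFun he ⟨g, hg⟩
  have h3 := hev g
  rw [h2, zero_add] at h3
  rw [map_mul, h3, one_mul] at h1
  exact hPg h1

/-! ### Differentials of rational representations -/

section Rep

variable {G : Subgroup (GLC n)} {V : Type*} [AddCommGroup V] [Module ℂ V]
  {ρ : Representation ℂ G V}

lemma expElt_add (X : lieAlg G) (s t : ℂ) : expElt X (s + t) = expElt X s * expElt X t :=
  Subtype.ext (expGL_add X.1 s t)

@[simp] lemma expElt_zero (X : lieAlg G) : expElt X 0 = 1 :=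
  Subtype.ext (by simp [expElt])

lemma IsRational.exists_poly (hρ : IsRational ρ) (ξ : Module.Dual ℂ V) (w : V) :
    ∃ P : PolyRing n, ∀ g : G, ξ (ρ g w) = ev (g : GLC n) P :=
  mem_coordRing_iff.1 (hρ ξ w)

lemma hasDerivAt_of_poly {ξ : Module.Dual ℂ V} {w : V} {P : PolyRing n}
    (hP : ∀ g : G, ξ (ρ g w) = ev (g : GLC n) P) (X : lieAlg G) :
    HasDerivAt (fun s : ℂ => ξ (ρ (expElt X s) w)) (ev 1 (leftDer X.1 P)) 0 := by
  simpa only [hP, expElt, one_mul] using hasDerivAt_ev_zero 1 X.1 P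

variable [FiniteDimensional ℂ V]

/-- The derivative at 1 is computed by `leftDer`, which is linear in the matrix. This allows `dRep`
to be split along a decomposition into root vectors. -/
lemma exists_linear_dRep (hρ : IsRational ρ) :
    ∃ L : MatC n →ₗ[ℂ] Module.End ℂ V, ∀ X : lieAlg G, dRep ρ X = L X.1 := by
  let b := Module.finBasis ℂ V
  choose P hP using fun i j => hρ.exists_poly (b.coord i) (b j)
  let Q : MatC n →ₗ[ℂ] (Fin (Module.finrank ℂ V) → V) := LinearMap.pi fun j =>
    ∑ i, ((ev 1).toLinearMap.comp (leftDerLin (P i j))).smulRight (b i)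
  refine ⟨(b.constr ℂ).toLinearMap.comp Q, fun X => b.ext fun j => ?_⟩
  have hd : ∀ i, deriv (fun s : ℂ => b.repr (ρ (expElt X s) (b j)) i) 0 =
      ev 1 (leftDer X.1 (P i j)) := fun i => (hasDerivAt_of_poly (hP i j) X).deriv
  have h1 : dRep ρ X (b j) = ∑ i, ev 1 (leftDer X.1 (P i j)) • b i := by
    rw [dRep]
    simp only [← hd]
    exact b.constr_basis ℂ _ j
  rw [h1]
  simp [Q]

/-- Frees `dRep` from the basis chosen in its definition. -/
lemma hasDerivAt_dRep_zero (hρ : IsRational ρ) (X : lieAlg G) (ξ : Module.Dual ℂ V) (w : V) :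
    HasDerivAt (fun s : ℂ => ξ (ρ (expElt X s) w)) (ξ (dRep ρ X w)) 0 := by
  let b := Module.finBasis ℂ V
  have hb : ∀ j, HasDerivAt (fun s : ℂ => ξ (ρ (expElt X s) (b j))) (ξ (dRep ρ X (b j))) 0 := by
    intro j
    have h1 : dRep ρ X (b j) =
        ∑ i, deriv (fun s : ℂ => b.repr (ρ (expElt X s) (b j)) i) 0 • b i := by
      rw [dRep]
      exact b.constr_basis ℂ _ j
    have h2 : ∀ i, HasDerivAt (fun s : ℂ => b.repr (ρ (expElt X s) (b j)) i)
        (deriv (fun s : ℂ => b.repr (ρ (expElt X s) (b j)) i) 0) 0 := by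
      intro i
      obtain ⟨P, hP⟩ := hρ.exists_poly (b.coord i) (b j)
      exact (hasDerivAt_of_poly hP X).differentiableAt.hasDerivAt
    have h3 := HasDerivAt.fun_sum (u := Finset.univ) fun i _ => (h2 i).mul_const (ξ (b i))
    rw [h1, map_sum]
    simp only [map_smul, smul_eq_mul]
    refine h3.congr_of_eventuallyEq (Filter.Eventually.of_forall fun s => ?_)
    dsimp only
    conv_lhs => rw [← b.sum_repr (ρ (expElt X s) (b j)), map_sum]
    simp only [map_smul, smul_eq_mul]
  have h := HasDerivAt.fun_sum (u := Finset.univ) fun j _ => (hb j).const_mul (b.repr w j)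
  have e : ∀ T : Module.End ℂ V, ∑ j, b.repr w j * ξ (T (b j)) = ξ (T w) := by
    intro T
    conv_rhs => rw [← b.sum_repr w, map_sum, map_sum]
    simp only [map_smul, smul_eq_mul]
  simpa only [e] using h

lemma hasDerivAt_dRep (hρ : IsRational ρ) (X : lieAlg G) (ξ : Module.Dual ℂ V) (w : V) (s : ℂ) :
    HasDerivAt (fun s : ℂ => ξ (ρ (expElt X s) w)) (ξ (ρ (expElt X s) (dRep ρ X w))) s := by
  have h := hasDerivAt_dRep_zero hρ X (ξ.comp (ρ (expElt X s))) w
  have h' : HasDerivAt (fun t : ℂ => (ξ.comp (ρ (expElt X s))) (ρ (expElt X t) w))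
      (ξ (ρ (expElt X s) (dRep ρ X w))) (s - s) := by rw [sub_self]; exact h
  have h2 := h'.comp_sub_const s s
  refine h2.congr_of_eventuallyEq (Filter.Eventually.of_forall fun t => ?_)
  dsimp only
  rw [LinearMap.comp_apply, ← Module.End.mul_apply, ← map_mul, ← expElt_add, add_sub_cancel]

/-- Both sides are the derivative at 0 of `ρ (g exp (sX)) w`, because `g exp (sX) = exp (s gXg⁻¹)
g`. -/
lemma dRep_conj (hρ : IsRational ρ) (g : G) (X : lieAlg G) (w : V) :
    dRep ρ ⟨((g : GLC n) : MatC n) * X.1 * (((g : GLC n)⁻¹ : GLC n) : MatC n),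
      conj_mem_lieAlg g.2 X.2⟩ (ρ g w) = ρ g (dRep ρ X w) := by
  rw [← sub_eq_zero, ← Module.forall_dual_apply_eq_zero_iff ℂ]
  intro ξ
  rw [map_sub, sub_eq_zero]
  refine (hasDerivAt_dRep_zero hρ _ ξ (ρ g w)).unique ?_
  refine (hasDerivAt_dRep_zero hρ X (ξ.comp (ρ g)) w).congr_of_eventuallyEq
    (Filter.Eventually.of_forall fun s => ?_)
  have : expElt (H := G) ⟨((g : GLC n) : MatC n) * X.1 * (((g : GLC n)⁻¹ : GLC n) : MatC n),
      conj_mem_lieAlg g.2 X.2⟩ s = g * expElt X s * g⁻¹ := by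
    refine Subtype.ext ?_
    change expGL (s • (((g : GLC n) : MatC n) * X.1 * (((g : GLC n)⁻¹ : GLC n) : MatC n))) = _
    rw [← smul_mul_assoc, ← mul_smul_comm, expGL_conj]
    rfl
  dsimp only
  rw [this, LinearMap.comp_apply, ← Module.End.mul_apply, ← Module.End.mul_apply, ← map_mul,
    ← map_mul, inv_mul_cancel_right]

omit [FiniteDimensional ℂ V] in
lemma mem_of_dual (W : Submodule ℂ V) {w : V}
    (h : ∀ ξ : Module.Dual ℂ V, (∀ x ∈ W, ξ x = 0) → ξ w = 0) : w ∈ W := by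
  by_contra hw
  obtain ⟨ξ, hξ, hW⟩ := Submodule.exists_le_ker_of_notMem hw
  exact hξ (h ξ fun x hx => hW hx)

/-- A curve in a subspace has its derivative there; only the curve through the single vector `w` has
to be controlled. -/
lemma dRep_mem (hρ : IsRational ρ) {X : lieAlg G} {W : Submodule ℂ V} {w : V}
    (h : ∀ s, ρ (expElt X s) w ∈ W) : dRep ρ X w ∈ W := by
  refine mem_of_dual W fun ξ hξ => ?_
  have h1 : HasDerivAt (fun s : ℂ => ξ (ρ (expElt X s) w)) 0 0 :=
    (hasDerivAt_const (0 : ℂ) (0 : ℂ)).congr_of_eventuallyEq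
      (Filter.Eventually.of_forall fun s => hξ _ (h s))
  exact (hasDerivAt_dRep_zero hρ X ξ w).unique h1

lemma hasDerivAt_dRep_pow (hρ : IsRational ρ) (X : lieAlg G) (ξ : Module.Dual ℂ V) (w : V)
    (k : ℕ) (s : ℂ) :
    HasDerivAt (fun s : ℂ => ξ (ρ (expElt X s) ((dRep ρ X ^ k) w)))
      (ξ (ρ (expElt X s) ((dRep ρ X ^ (k + 1)) w))) s := by
  rw [pow_succ']
  exact hasDerivAt_dRep hρ X ξ _ s

/-- For a form `ξ` that is zero on `W`, all derivatives at 0 of `s ↦ ξ (exp (sX) w)` vanish. -/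
lemma exp_mem_of_dRep_mem (hρ : IsRational ρ) {X : lieAlg G} {W : Submodule ℂ V}
    (h : ∀ w ∈ W, dRep ρ X w ∈ W) {w : V} (hw : w ∈ W) (s : ℂ) : ρ (expElt X s) w ∈ W := by
  refine mem_of_dual W fun ξ hξ => ?_
  have hk : ∀ k : ℕ, (dRep ρ X ^ k) w ∈ W := by
    intro k
    induction k with
    | zero => exact hw
    | succ k ih => rw [pow_succ']; exact h _ ih
  exact eq_zero_of_iterated_derivs
    (F := fun k s => ξ (ρ (expElt X s) ((dRep ρ X ^ k) w)))
    (fun k s => hasDerivAt_dRep_pow hρ X ξ w k s) (fun k => by simp [hξ _ (hk k)]) s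

/-- A subspace stable under the Lie algebra of a connected group is stable under the group. -/
theorem mem_of_dRep_mem (hG : IsZariskiClosed G) (hc : IsZariskiConnected G) (hρ : IsRational ρ)
    {W : Submodule ℂ V} (h : ∀ X : lieAlg G, ∀ w ∈ W, dRep ρ X w ∈ W) (g : G) {w : V}
    (hw : w ∈ W) : ρ g w ∈ W := by
  -- The equivalence makes closure under inverses immediate; `hS` recovers it from one inclusion by
  -- comparing dimensions.
  let S : Subgroup G :=
    { carrier := {g | ∀ w, ρ g w ∈ W ↔ w ∈ W}
      mul_mem' := fun {a b} ha hb w => by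
        rw [map_mul, Module.End.mul_apply]
        exact (ha _).trans (hb _)
      one_mem' := fun w => by simp
      inv_mem' := fun {a} ha w => by
        rw [← ha, ← Module.End.mul_apply, ← map_mul, mul_inv_cancel, map_one, Module.End.one_apply] }
  have hS : ∀ g : G, (∀ w ∈ W, ρ g w ∈ W) → g ∈ S := by
    intro g hg w
    refine ⟨fun hgw => ?_, hg w⟩
    have hinj : Function.Injective (ρ g) := fun a b hab => by
      have := congrArg (ρ g⁻¹) hab
      simpa [← Module.End.mul_apply, ← map_mul] using this
    have hle : W.map (ρ g) ≤ W := by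
      rintro _ ⟨x, hx, rfl⟩
      exact hg x hx
    have heq : W.map (ρ g) = W := Submodule.eq_of_le_of_finrank_eq hle
      (LinearEquiv.finrank_eq (Submodule.equivMapOfInjective _ hinj W)).symm
    rw [← heq] at hgw
    obtain ⟨x, hx, hxw⟩ := hgw
    rwa [← hinj hxw]
  have hle := le_of_expGL_mem hG hc (H := S.map G.subtype)
    (by rintro _ ⟨g, _, rfl⟩; exact g.2)
    (fun Y hY s => ⟨expElt ⟨Y, hY⟩ s,
      hS _ fun w hw => exp_mem_of_dRep_mem hρ (h ⟨Y, hY⟩) hw s, rfl⟩)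
    -- The stabilizer is cut out by the matrix coefficients `ξ (g w)` with `w ∈ W` and `ξ` zero on
    -- `W`.
    (fun g hg hgS => by
      have : ∃ w ∈ W, ρ ⟨g, hg⟩ w ∉ W := by
        by_contra! hcon
        exact hgS ⟨⟨g, hg⟩, hS _ hcon, rfl⟩
      obtain ⟨w, hw, hgw⟩ := this
      obtain ⟨ξ, hξ, hWξ⟩ := Submodule.exists_le_ker_of_notMem hgw
      obtain ⟨P, hP⟩ := hρ.exists_poly ξ w
      refine ⟨P, ?_, ?_⟩
      · rintro _ ⟨x, hx, rfl⟩
        change ev (x : GLC n) P = 0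
        rw [← hP]
        exact hWξ ((hx w).2 hw)
      · rwa [← hP ⟨g, hg⟩])
  obtain ⟨x, hx, hxg⟩ := hle g.2
  have : x = g := Subtype.ext hxg
  subst this
  exact (hx w).2 hw

/-! ### Nilpotent elements -/

lemma exists_polynomial_exp_entry {X : MatC n} (hX : IsNilpotent X) (i j : Fin n) :
    ∃ p : Polynomial ℂ, ∀ s : ℂ, (expGL (s • X) : MatC n) i j = p.eval s := by
  obtain ⟨M, hM⟩ := hX
  refine ⟨∑ k ∈ Finset.range M,
    Polynomial.C ((k.factorial : ℂ)⁻¹ * (X ^ k) i j) * Polynomial.X ^ k, fun s => ?_⟩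
  let : NormedRing (MatC n) := Matrix.linftyOpNormedRing
  let : NormedAlgebra ℂ (MatC n) := Matrix.linftyOpNormedAlgebra
  have : (expGL (s • X) : MatC n) = ∑ k ∈ Finset.range M, (k.factorial : ℂ)⁻¹ • (s • X) ^ k := by
    change NormedSpace.exp (s • X) = _
    rw [NormedSpace.exp_eq_tsum ℂ]
    refine tsum_eq_sum fun k hk => ?_
    rw [smul_pow, pow_eq_zero_of_le (by simpa using hk) hM, smul_zero, smul_zero]
  rw [this, Matrix.sum_apply, Polynomial.eval_finsetSum]
  refine Finset.sum_congr rfl fun k _ => ?_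
  simp [smul_pow]
  ring

lemma exists_polynomial_ev {X : MatC n} (hX : IsNilpotent X) (P : PolyRing n) :
    ∃ p : Polynomial ℂ, ∀ s : ℂ, ev (expGL (s • X)) P = p.eval s := by
  choose p hp using exists_polynomial_exp_entry hX
  induction P using MvPolynomial.induction_on with
  | C a => exact ⟨Polynomial.C a, fun s => by simp [← algebraMap_eq]⟩
  | add P Q hP hQ =>
    obtain ⟨a, ha⟩ := hP
    obtain ⟨b, hb⟩ := hQ
    exact ⟨a + b, fun s => by simp [ha, hb]⟩
  | mul_X P o hP =>
    obtain ⟨a, ha⟩ := hP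
    have : ∃ p : Polynomial ℂ, ∀ s : ℂ, ev (expGL (s • X)) (MvPolynomial.X o) = p.eval s := by
      rcases o with _ | ⟨i, j⟩
      -- The inverse of `det (exp (sX))` is `det (exp (-sX))`, again polynomial in `s`.
      · refine ⟨((Matrix.of p).det).comp (-Polynomial.X), fun s => ?_⟩
        have h1 : expGL (s • X) * expGL ((-s) • X) = 1 := by
          rw [← expGL_add, add_neg_cancel, zero_smul, expGL_zero]
        have h2 : (expGL (s • X) : MatC n).det * (expGL ((-s) • X) : MatC n).det = 1 := by
          rw [← Matrix.det_mul, ← Units.val_mul, h1, Units.val_one, Matrix.det_one]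
        rw [ev_X_none, inv_eq_of_mul_eq_one_right h2, Polynomial.eval_comp, Polynomial.eval_neg,
          Polynomial.eval_X, ← Polynomial.coe_evalRingHom, RingHom.map_det]
        congr 1
        ext i j
        simpa using hp i j (-s)
      · exact ⟨p i j, fun s => by rw [ev_X_some, hp]⟩
    obtain ⟨b, hb⟩ := this
    exact ⟨a * b, fun s => by simp [ha, hb]⟩

/-- Matrix coefficients along `exp (sX)` are polynomials in `s`, whose derivatives at 0 are the
coefficients of the powers of `dRep ρ X`. A degree bound `M` for a basis kills high powers, and
Taylor's formula is the finite exponential series. -/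
lemma rep_expElt_of_isNilpotent (hρ : IsRational ρ) {X : lieAlg G} (hX : IsNilpotent X.1) :
    ∃ M : ℕ, (∀ k, M ≤ k → dRep ρ X ^ k = 0) ∧ ∀ s : ℂ, ρ (expElt X s) =
      ∑ k ∈ Finset.range M, s ^ k • ((k.factorial : ℂ)⁻¹ • dRep ρ X ^ k) := by
  let b := Module.finBasis ℂ V
  have hpoly : ∀ (ξ : Module.Dual ℂ V) (w : V), ∃ p : Polynomial ℂ, ∀ (k : ℕ) (s : ℂ),
      ξ (ρ (expElt X s) ((dRep ρ X ^ k) w)) = (Polynomial.derivative^[k] p).eval s := by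
    intro ξ w
    obtain ⟨P, hP⟩ := hρ.exists_poly ξ w
    obtain ⟨p, hp⟩ := exists_polynomial_ev hX P
    refine ⟨p, fun k => ?_⟩
    induction k with
    | zero => intro s; rw [pow_zero, Module.End.one_apply, hP]; exact hp s
    | succ k ih =>
      intro s
      rw [Function.iterate_succ_apply']
      refine (hasDerivAt_dRep_pow hρ X ξ w k s).unique ?_
      rw [funext ih]
      exact Polynomial.hasDerivAt _ s
  choose p hp using fun i j => hpoly (b.coord i) (b j)
  let M := (Finset.univ.sup fun ij : Fin (Module.finrank ℂ V) × Fin (Module.finrank ℂ V) =>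
    (p ij.1 ij.2).natDegree) + 1
  have hM : ∀ i j, (p i j).natDegree < M := fun i j => Nat.lt_succ_of_le
    (Finset.le_sup (f := fun ij : Fin (Module.finrank ℂ V) × Fin (Module.finrank ℂ V) =>
      (p ij.1 ij.2).natDegree) (Finset.mem_univ (i, j)))
  refine ⟨M, fun k hk => b.ext fun j => b.ext_elem fun i => ?_,
    fun s => b.ext fun j => b.ext_elem fun i => ?_⟩
  · have := hp i j k 0
    rw [Polynomial.iterate_derivative_eq_zero ((hM i j).trans_le hk)] at this
    simpa using this
  · have h0 := hp i j 0 s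
    have hk : ∀ k, b.repr ((dRep ρ X ^ k) (b j)) i = k.factorial * (p i j).coeff k := by
      intro k
      have := hp i j k 0
      rw [← Polynomial.coeff_zero_eq_eval_zero, Polynomial.coeff_iterate_derivative] at this
      simpa [Nat.descFactorial_self] using this
    simp only [pow_zero, Module.End.one_apply, Function.iterate_zero, id] at h0
    rw [Polynomial.eval_eq_sum_range' (hM i j)] at h0
    refine Eq.trans h0 ?_
    simp only [LinearMap.sum_apply, LinearMap.smul_apply, map_sum, map_smul, Finsupp.coe_finsetSum,
      Finset.sum_apply, Finsupp.smul_apply, hk, smul_eq_mul]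
    refine Finset.sum_congr rfl fun k _ => ?_
    have : (k.factorial : ℂ) ≠ 0 := by exact_mod_cast k.factorial_ne_zero
    field_simp

end Rep

/-! ### Nilpotent matrices -/

section Nilpotent

lemma eq_zero_of_idempotent_of_trace {e : MatC n} (he : e * e = e) (ht : e.trace = 0) : e = 0 := by
  have h1 : IsIdempotentElem (Matrix.toLin' e) := by
    rw [IsIdempotentElem, Module.End.mul_eq_comp, ← Matrix.toLin'_mul, he]
  have h2 := LinearMap.IsIdempotentElem.eq_zero_of_trace_eq_zero h1
    (by rw [Matrix.trace_toLin'_eq, ht])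
  simpa using h2

/-- A commutator `[X, Z]` that commutes with `X` is nilpotent. -/
lemma isNilpotent_commutator {X Z : MatC n} (h : Commute X (X * Z - Z * X)) :
    IsNilpotent (X * Z - Z * X) := by
  set C := X * Z - Z * X with hC
  -- For `B` commuting with `X`, the product `C B` is the commutator `[X, Z B]`.
  have htr : ∀ B, Commute X B → (C * B).trace = 0 := by
    intro B hB
    rw [hC, sub_mul, Matrix.trace_sub, mul_assoc Z, hB.eq, ← mul_assoc, mul_assoc X,
      Matrix.trace_mul_comm X, sub_self]
  have hp0 : C.charpoly ≠ 0 := C.charpoly_monic.ne_zero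
  -- The characteristic polynomial is `T^m q` with `q` prime to `T`. Bézout gives an idempotent `e =
  -- a(C) C^(m+1)`, the projection to the nonzero generalized eigenspaces. It is a multiple of `C`
  -- by a polynomial in `C`, so its trace is zero by `htr`; hence `e = 0` and `C^m = 0`.
  obtain ⟨q, hq, hndvd⟩ := Polynomial.exists_eq_pow_rootMultiplicity_mul_and_not_dvd
    C.charpoly hp0 0
  rw [Polynomial.C_0, sub_zero] at hq hndvd
  set m := Polynomial.rootMultiplicity 0 C.charpoly
  have hcop : IsCoprime (Polynomial.X ^ (m + 1)) q :=
    ((Polynomial.irreducible_X.coprime_iff_not_dvd).2 hndvd).pow_left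
  obtain ⟨a, b, hab⟩ := hcop
  have hzero : C ^ m * Polynomial.aeval C q = 0 := by
    have := Matrix.aeval_self_charpoly C
    rw [hq] at this
    simpa using this
  have hab' : Polynomial.aeval C a * C ^ (m + 1) +
      Polynomial.aeval C b * Polynomial.aeval C q = 1 := by
    have := congrArg (Polynomial.aeval C) hab
    simpa using this
  have hcomm : ∀ r : Polynomial ℂ, Commute C (Polynomial.aeval C r) := fun r =>
    by simpa using (Commute.all Polynomial.X r).map (Polynomial.aeval C)
  have hXcomm : ∀ r : Polynomial ℂ, Commute X (Polynomial.aeval C r) := by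
    intro r
    induction r using Polynomial.induction_on' with
    | add p q hp hq => rw [map_add]; exact hp.add_right hq
    | monomial k a => rw [Polynomial.aeval_monomial]
                      exact (Algebra.commute_algebraMap_right a X).mul_right (h.pow_right k)
  set e := Polynomial.aeval C a * C ^ (m + 1) with he
  have hez : e * (Polynomial.aeval C b * Polynomial.aeval C q) = 0 := by
    have h1 : Commute (Polynomial.aeval C b) (Polynomial.aeval C q) :=
      (Commute.all b q).map (Polynomial.aeval C)
    rw [he, h1.eq, pow_succ', mul_assoc, mul_assoc, ← mul_assoc (C ^ m), hzero]
    simp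
  have hid : e * e = e := by
    have h1 : e = 1 - Polynomial.aeval C b * Polynomial.aeval C q := eq_sub_of_add_eq hab'
    conv_lhs => rhs; rw [h1]
    rw [mul_sub, hez, mul_one, sub_zero]
  have het : e.trace = 0 := by
    have : e = C * (Polynomial.aeval C a * C ^ m) := by
      rw [he, pow_succ', ← mul_assoc, ← (hcomm a).eq, mul_assoc]
    rw [this]
    exact htr _ ((hXcomm a).mul_right (h.pow_right m))
  have he0 := eq_zero_of_idempotent_of_trace hid het
  rw [he0, zero_add] at hab'
  refine ⟨m, ?_⟩
  have h1 : Commute (Polynomial.aeval C b) (Polynomial.aeval C q) :=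
    (Commute.all b q).map (Polynomial.aeval C)
  rw [← mul_one (C ^ m), ← hab', h1.eq, ← mul_assoc, hzero, zero_mul]

/-- If `X` is nilpotent and `[X, [X, Z]] = 0`, then `X Z` is nilpotent. -/
lemma isNilpotent_mul_of_commute {X Z : MatC n} (hX : IsNilpotent X)
    (h : Commute X (X * Z - Z * X)) : IsNilpotent (X * Z) := by
  set C := X * Z - Z * X with hC
  obtain ⟨m, hm⟩ := isNilpotent_commutator h
  rw [← hC] at hm
  obtain ⟨M, hM⟩ := hX
  have hXZ : ∀ j : ℕ, X ^ (j + 1) * Z = Z * X ^ (j + 1) + ((j + 1 : ℕ) : ℂ) • (C * X ^ j) := by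
    intro j
    induction j with
    | zero => simp [hC]
    | succ j ih =>
      have h1 : X * Z = Z * X + C := by rw [hC]; abel
      rw [pow_succ' X (j + 1), mul_assoc, ih, mul_add, ← mul_assoc, h1, add_mul, mul_smul_comm,
        ← mul_assoc X C, h.eq, mul_assoc C X, ← pow_succ', mul_assoc, ← pow_succ',
        add_assoc]
      congr 1
      push_cast
      module
  -- The operator `X Z` preserves the kernel of `X^(j+1)` and becomes `(j+1) C` after applying
  -- `X^j`. As `C^m = 0`, its `m`-th power maps this kernel into that of `X^j`.
  have key : ∀ (j : ℕ) (B : MatC n), X ^ (j + 1) * B = 0 → ∀ k : ℕ,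
      X ^ (j + 1) * ((X * Z) ^ k * B) = 0 ∧
      X ^ j * ((X * Z) ^ k * B) = ((j + 1 : ℕ) : ℂ) ^ k • (C ^ k * (X ^ j * B)) := by
    intro j B hB k
    induction k with
    | zero => simpa using hB
    | succ k ih =>
      set B' := (X * Z) ^ k * B with hB'
      have e1 : (X * Z) ^ (k + 1) * B = X * (Z * B') := by
        rw [pow_succ', mul_assoc, mul_assoc]
      have e2 : X ^ (j + 1) * (Z * B') = ((j + 1 : ℕ) : ℂ) • (C * (X ^ j * B')) := by
        rw [← mul_assoc, hXZ, add_mul, mul_assoc, ih.1, mul_zero, zero_add, smul_mul_assoc,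
          mul_assoc]
      constructor
      · rw [e1, ← mul_assoc, ← pow_succ, pow_succ', mul_assoc, e2, mul_smul_comm, ← mul_assoc,
          h.eq, mul_assoc, ← mul_assoc X, ← pow_succ', ih.1, mul_zero, smul_zero]
      · rw [e1, ← mul_assoc, ← pow_succ, e2, ih.2, mul_smul_comm, smul_smul, pow_succ', pow_succ',
          mul_assoc]
  have hdesc : ∀ i : ℕ, X ^ (M - i) * (X * Z) ^ (m * i) = 0 := by
    intro i
    induction i with
    | zero => simpa using hM
    | succ i ih =>
      rcases Nat.lt_or_ge i M with hi | hi
      · have e : M - i = (M - (i + 1)) + 1 := by omega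
        rw [e] at ih
        have := (key _ _ ih m).2
        rw [hm, zero_mul, smul_zero, ← pow_add] at this
        rw [mul_add, mul_one, add_comm (m * i)]
        exact this
      · have e1 : M - i = 0 := by omega
        have e2 : M - (i + 1) = 0 := by omega
        rw [e1, pow_zero, one_mul] at ih
        rw [e2, pow_zero, one_mul, mul_add, pow_add, ih, zero_mul]
  exact ⟨m * M, by simpa using hdesc M⟩

/-- The inner derivation `[X, ·]`. -/
def adMat (X : MatC n) : MatC n →ₗ[ℂ] MatC n := LinearMap.mulLeft ℂ X - LinearMap.mulRight ℂ X

@[simp] lemma adMat_apply (X Y : MatC n) : adMat X Y = X * Y - Y * X := rfl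

/-- A nilpotent matrix `X` lies in the image of `[X, [X, ·]]`. -/
lemma exists_adMat_adMat_eq {X : MatC n} (hX : IsNilpotent X) : ∃ Y, adMat X (adMat X Y) = X := by
  suffices X ∈ LinearMap.range (adMat X ∘ₗ adMat X) by
    obtain ⟨Y, hY⟩ := this
    exact ⟨Y, hY⟩
  refine mem_of_dual _ fun θ hθ => ?_
  -- `θ` is the trace form against `Z`, and `ad X` is skew for that form. So `θ` kills the image of
  -- `(ad X)²` only if `(ad X)² Z = 0`; then `X Z` is nilpotent and `θ X`, its trace, is zero.
  let Z : MatC n := Matrix.of fun i j => θ (Matrix.single j i 1)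
  have hZ : ∀ Y, θ Y = (Z * Y).trace := by
    intro Y
    conv_lhs => rw [Matrix.matrix_eq_sum_single Y]
    simp only [map_sum, Matrix.trace, Matrix.diag_apply, Matrix.mul_apply]
    rw [Finset.sum_comm]
    refine Finset.sum_congr rfl fun i _ => Finset.sum_congr rfl fun j _ => ?_
    have : Matrix.single j i (Y j i) = Y j i • Matrix.single j i (1 : ℂ) := by simp
    rw [this, map_smul, smul_eq_mul, mul_comm]
    rfl
  have hadj : ∀ A B : MatC n, (A * adMat X B).trace = - (adMat X A * B).trace := by
    intro A B
    simp only [adMat_apply, mul_sub, sub_mul, Matrix.trace_sub]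
    rw [← mul_assoc, ← mul_assoc, Matrix.trace_mul_comm (A * B) X, ← mul_assoc]
    ring
  have h0 : adMat X (adMat X Z) = 0 := by
    refine Matrix.ext_iff_trace_mul_right.2 fun B => ?_
    have h1 := hθ _ ⟨B, rfl⟩
    rw [hZ, LinearMap.comp_apply, hadj, hadj, neg_neg] at h1
    rw [h1, zero_mul, Matrix.trace_zero]
  have hcomm : Commute X (X * Z - Z * X) := sub_eq_zero.1 h0
  rw [hZ, Matrix.trace_mul_comm]
  exact (Matrix.isNilpotent_trace_of_isNilpotent (isNilpotent_mul_of_commute hX hcomm)).eq_zero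

end Nilpotent

/-! ### Independence of characters -/

/-- Components along distinct characters are independent. -/
lemma sum_filter_eq_zero_of_characters {M ι V : Type*} [Monoid M] [AddCommGroup V] [Module ℂ V]
    (s : Finset ι) (ψ : ι → M →* ℂˣ) (w : ι → V) (h : ∀ t, ∑ i ∈ s, ((ψ i t : ℂˣ) : ℂ) • w i = 0)
    [DecidableEq (M →* ℂˣ)] (χ : M →* ℂˣ) : ∑ i ∈ s with ψ i = χ, w i = 0 := by
  rw [← Module.forall_dual_apply_eq_zero_iff ℂ]
  intro θ
  rw [map_sum]
  have hinj : Function.Injective fun ψ : M →* ℂˣ => (Units.coeHom ℂ).comp ψ := fun a b hab =>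
    MonoidHom.ext fun t => Units.ext (DFunLike.congr_fun hab t)
  -- Dedekind's independence of characters.
  have hli := (linearIndependent_monoidHom M ℂ).comp _ hinj
  have h2 : ∑ χ ∈ s.image ψ, (∑ i ∈ s with ψ i = χ, θ (w i)) •
      (fun t : M => ((χ t : ℂˣ) : ℂ)) = 0 := by
    funext t
    have h1 := congrArg θ (h t)
    rw [map_sum, map_zero, ← Finset.sum_fiberwise_of_maps_to (t := s.image ψ) (g := ψ)
      (fun i hi => Finset.mem_image_of_mem _ hi)] at h1
    rw [Finset.sum_apply, Pi.zero_apply, ← h1]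
    refine Finset.sum_congr rfl fun χ _ => ?_
    rw [Pi.smul_apply, smul_eq_mul, Finset.sum_mul]
    refine Finset.sum_congr rfl fun i hi => ?_
    rw [map_smul, smul_eq_mul, (Finset.mem_filter.1 hi).2, mul_comm]
  by_cases hχ : χ ∈ s.image ψ
  · exact linearIndependent_iff'.1 hli _ _ h2 χ hχ
  · rw [Finset.filter_false_of_mem, Finset.sum_empty]
    rintro i hi rfl
    exact hχ (Finset.mem_image_of_mem _ hi)

/-! ### Complete reducibility -/

/-- `IsConnectedReductive` speaks of spaces in `Type` only, so a space in any universe is first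
replaced by its coordinate space. -/
lemma IsConnectedReductive.exists_isCompl {G : Subgroup (GLC n)} (hG : IsConnectedReductive G)
    {V : Type*} [AddCommGroup V] [Module ℂ V] [FiniteDimensional ℂ V] {ρ : Representation ℂ G V}
    (hρ : IsRational ρ) {K : Submodule ℂ V} (hK : ∀ g, ∀ w ∈ K, ρ g w ∈ K) :
    ∃ K' : Submodule ℂ V, IsCompl K K' ∧ ∀ g, ∀ w ∈ K', ρ g w ∈ K' := by
  let e : V ≃ₗ[ℂ] (Fin (Module.finrank ℂ V) → ℂ) := (Module.finBasis ℂ V).equivFun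
  let ρ' : Representation ℂ G (Fin (Module.finrank ℂ V) → ℂ) :=
    { toFun := fun g => e.toLinearMap ∘ₗ ρ g ∘ₗ e.symm.toLinearMap
      map_one' := by ext; simp
      map_mul' := fun a b => by ext; simp }
  have hρ' : IsRational ρ' := fun φ v => hρ (φ.comp e.toLinearMap) (e.symm v)
  have := hG.reductive _ ρ' hρ'
  let S : Subrepresentation ρ' :=
    { toSubmodule := K.comap e.symm.toLinearMap
      apply_mem_toSubmodule := fun g v hv => by
        simpa [ρ'] using hK g _ hv }
  obtain ⟨S', hS'⟩ := ComplementedLattice.exists_isCompl S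
  refine ⟨S'.toSubmodule.comap e.toLinearMap, ⟨?_, ?_⟩, fun g w hw => ?_⟩
  · rw [Submodule.disjoint_def]
    intro x hx hx'
    have h1 : S ⊓ S' = ⊥ := hS'.inf_eq_bot
    have h2 : e x ∈ (S ⊓ S').toSubmodule := ⟨by simpa [S] using hx, hx'⟩
    rw [h1] at h2
    have h3 : e x = 0 := h2
    simpa using h3
  · rw [codisjoint_iff, eq_top_iff]
    intro x _
    have h1 : S ⊔ S' = ⊤ := hS'.sup_eq_top
    have h2 : e x ∈ (S ⊔ S').toSubmodule := by rw [h1]; trivial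
    obtain ⟨a, ha, b, hb, hab⟩ := Submodule.mem_sup.1 h2
    refine Submodule.mem_sup.2 ⟨e.symm a, ha, e.symm b, by simpa using hb, ?_⟩
    rw [← map_add, hab, e.symm_apply_apply]
  · have := S'.apply_mem_toSubmodule g hw
    simpa [ρ'] using this

/-! ### The adjoint action -/

lemma inv_entry_mem_coordRing (H : Subgroup (GLC n)) (i j : Fin n) :
    (fun h : H => (((h : GLC n)⁻¹ : GLC n) : MatC n) i j) ∈ coordRing H := by
  refine mem_coordRing_iff.2 ⟨X none *
    (Matrix.of fun i j : Fin n => (X (some (i, j)) : PolyRing n)).adjugate i j, fun h => ?_⟩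
  have h1 := congrFun (congrFun (AlgHom.map_adjugate (ev (h : GLC n))
    (Matrix.of fun i j : Fin n => (X (some (i, j)) : PolyRing n))) i) j
  have h2 : (ev (h : GLC n)).mapMatrix (Matrix.of fun i j : Fin n =>
      (X (some (i, j)) : PolyRing n)) = ((h : GLC n) : MatC n) := by
    ext i j
    simp
  rw [h2] at h1
  rw [map_mul, ev_X_none, Matrix.coe_units_inv, Matrix.inv_def, Ring.inverse_eq_inv',
    Matrix.smul_apply, smul_eq_mul, ← h1]
  rfl

/-- The conjugation action on all matrices. -/
def conjRep (G : Subgroup (GLC n)) : Representation ℂ G (MatC n) where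
  toFun g := LinearMap.mulLeft ℂ ((g : GLC n) : MatC n) ∘ₗ
    LinearMap.mulRight ℂ (((g : GLC n)⁻¹ : GLC n) : MatC n)
  map_one' := by ext1 Y; simp
  map_mul' a b := by ext1 Y; simp [mul_assoc]

lemma conjRep_apply (G : Subgroup (GLC n)) (g : G) (Y : MatC n) :
    conjRep G g Y = ((g : GLC n) : MatC n) * Y * (((g : GLC n)⁻¹ : GLC n) : MatC n) := by
  simp [conjRep, mul_assoc]

lemma isRational_conjRep (G : Subgroup (GLC n)) : IsRational (conjRep G) := by
  intro φ Y
  have : (fun g : G => φ (conjRep G g Y)) = ∑ i, ∑ j, ∑ k, ∑ l,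
      (φ (Matrix.single i j 1) * Y k l) • ((fun g : G => ((g : GLC n) : MatC n) i k) *
        fun g : G => (((g : GLC n)⁻¹ : GLC n) : MatC n) l j) := by
    funext g
    conv_lhs => rw [Matrix.matrix_eq_sum_single (conjRep G g Y)]
    simp only [map_sum, Finset.sum_apply]
    refine Finset.sum_congr rfl fun i _ => Finset.sum_congr rfl fun j _ => ?_
    have : Matrix.single i j (conjRep G g Y i j) =
      conjRep G g Y i j • Matrix.single i j (1 : ℂ) := by simp
    rw [this, map_smul, conjRep_apply, Matrix.mul_apply]
    simp only [Matrix.mul_apply, Finset.sum_mul, smul_eq_mul, Pi.smul_apply, Pi.mul_apply]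
    rw [Finset.sum_comm]
    refine Finset.sum_congr rfl fun k _ => Finset.sum_congr rfl fun l _ => ?_
    ring
  rw [this]
  refine sum_mem fun i _ => sum_mem fun j _ => sum_mem fun k _ => sum_mem fun l _ => ?_
  have h1 : (fun g : G => ((g : GLC n) : MatC n) i k) ∈ coordRing G :=
    Algebra.subset_adjoin (Or.inl ⟨i, k, rfl⟩)
  exact (coordRing G).smul_mem ((coordRing G).mul_mem h1 (inv_entry_mem_coordRing G l j)) _

lemma dRep_conjRep {G : Subgroup (GLC n)} (X : lieAlg G) : dRep (conjRep G) X = adMat X.1 := by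
  ext1 Y
  ext i j
  refine (hasDerivAt_dRep_zero (isRational_conjRep G) X (Matrix.entryLinearMap ℂ ℂ i j) Y).unique ?_
  let : NormedRing (MatC n) := Matrix.linftyOpNormedRing
  let : NormedAlgebra ℂ (MatC n) := Matrix.linftyOpNormedAlgebra
  have h1 := hasDerivAt_exp_smul_const (𝕂 := ℂ) X.1 0
  have h2 := hasDerivAt_exp_smul_const (𝕂 := ℂ) (-X.1) 0
  have h3 := (h1.mul_const Y).mul h2
  have h4 := hasDerivAt_pi.1 (hasDerivAt_pi.1 h3 i) j
  have e : ∀ s, ((expElt X s : GLC n)⁻¹ : GLC n) = expGL (s • (-X.1)) := by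
    intro s
    rw [inv_eq_iff_mul_eq_one]
    change expGL (s • X.1) * _ = 1
    rw [smul_neg, ← neg_smul, ← expGL_add, add_neg_cancel, zero_smul, expGL_zero]
  have e2 : (fun s : ℂ => Matrix.entryLinearMap ℂ ℂ i j (conjRep G (expElt X s) Y)) =
      fun s => (NormedSpace.exp (s • X.1) * Y * NormedSpace.exp (s • (-X.1))) i j := by
    funext s
    rw [conjRep_apply, e]
    rfl
  rw [e2]
  refine h4.congr_deriv ?_
  simp [sub_eq_add_neg]

/-- The vector `-v` joins the family as an extra member `none` with character `χ`; then independence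
of characters applies. -/
lemma eq_sum_filter_of_weight {M ι V : Type*} [Monoid M] [AddCommGroup V] [Module ℂ V]
    (s : Finset ι) (ψ : ι → M →* ℂˣ) (w : ι → V) [DecidableEq (M →* ℂˣ)] (χ : M →* ℂˣ) (v : V)
    (h : ∀ t, ((χ t : ℂˣ) : ℂ) • v = ∑ i ∈ s, ((ψ i t : ℂˣ) : ℂ) • w i) :
    v = ∑ i ∈ s with ψ i = χ, w i := by
  have h1 := sum_filter_eq_zero_of_characters (Finset.insertNone s)
    (fun o => o.elim χ ψ) (fun o => o.elim (-v) w) (fun t => by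
      rw [Finset.sum_insertNone]
      simp [← h t]) χ
  rw [Finset.sum_filter, Finset.sum_insertNone, ← Finset.sum_filter] at h1
  simp only [Option.elim_none, if_true, Option.elim_some] at h1
  exact (eq_neg_of_add_eq_zero_right h1).trans (neg_neg v) |>.symm

/-! ### Weights of a torus -/

section Torus

variable {T : Subgroup (GLC n)} {P : GLC n}
  (hP : ∀ t ∈ T, ((P * t * P⁻¹ : GLC n) : MatC n).IsDiag)

/-- The diagonal entries of a diagonalized torus. -/
def diagHom (i : Fin n) : T →* ℂ where
  toFun t := ((P * t * P⁻¹ : GLC n) : MatC n) i i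
  map_one' := by simp
  map_mul' a b := by
    have : P * ((a * b : T) : GLC n) * P⁻¹ = (P * a * P⁻¹) * (P * b * P⁻¹) := by
      rw [Subgroup.coe_mul]
      group
    rw [this, Units.val_mul, Matrix.mul_apply]
    refine Finset.sum_eq_single i (fun k _ hk => ?_) (fun h => absurd (Finset.mem_univ i) h)
    rw [hP b b.2 hk, mul_zero]

/-- The diagonal entries as characters. -/
def diagChar (i : Fin n) : charLattice T :=
  ⟨(diagHom hP i).toHomUnits, by
    have key : ∀ M : T → MatC n, (∀ k l, (fun t => M t k l) ∈ coordRing T) →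
        (fun t => ((P : MatC n) * M t * ((P⁻¹ : GLC n) : MatC n)) i i) ∈ coordRing T := by
      intro M hM
      have : (fun t => ((P : MatC n) * M t * ((P⁻¹ : GLC n) : MatC n)) i i) =
          ∑ l, ∑ k, ((P : MatC n) i k * ((P⁻¹ : GLC n) : MatC n) l i) • fun t => M t k l := by
        funext t
        simp only [Matrix.mul_apply, Finset.sum_apply, Pi.smul_apply, smul_eq_mul, Finset.sum_mul]
        refine Finset.sum_congr rfl fun l _ => Finset.sum_congr rfl fun k _ => ?_
        ring
      rw [this]
      exact (coordRing T).sum_mem fun l _ => (coordRing T).sum_mem fun k _ =>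
        (coordRing T).smul_mem (hM k l) _
    refine ⟨key (fun t => ((t : GLC n) : MatC n)) fun k l =>
      Algebra.subset_adjoin (Or.inl ⟨k, l, rfl⟩), ?_⟩
    convert key (fun t => (((t : GLC n)⁻¹ : GLC n) : MatC n)) fun k l =>
      inv_entry_mem_coordRing T k l using 2 with t
    rw [← Units.val_inv_eq_inv_val, ← map_inv]
    rfl⟩

lemma diagonal_diagChar (t : T) : ((P * t * P⁻¹ : GLC n) : MatC n) =
    Matrix.diagonal fun i => (((diagChar hP i).1 t : ℂˣ) : ℂ) := by
  ext i j
  rcases eq_or_ne i j with rfl | hij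
  · rw [Matrix.diagonal_apply_eq]
    rfl
  · rw [Matrix.diagonal_apply_ne _ hij, hP t t.2 hij]

end Torus

/-- All matrices decompose into weight vectors of a torus. -/
lemma IsTorus.exists_weights {T : Subgroup (GLC n)} (hT : IsTorus T) :
    ∃ α : Fin n × Fin n → charLattice T, ∀ Y : MatC n, ∃ Z : Fin n × Fin n → MatC n,
      Y = ∑ i, Z i ∧ ∀ (t : T) i, ((t : GLC n) : MatC n) * Z i * (((t : GLC n)⁻¹ : GLC n) : MatC n) =
        (((α i).1 t : ℂˣ) : ℂ) • Z i := by
  obtain ⟨P, hP⟩ := hT.diagonalizable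
  refine ⟨fun ij => diagChar hP ij.1 * (diagChar hP ij.2)⁻¹, fun Y => ?_⟩
  let Y' : MatC n := (P : MatC n) * Y * ((P⁻¹ : GLC n) : MatC n)
  refine ⟨fun ij => ((P⁻¹ : GLC n) : MatC n) * Matrix.single ij.1 ij.2 (Y' ij.1 ij.2) * (P : MatC n),
    ?_, fun t ij => ?_⟩
  · rw [← Finset.sum_mul, ← Finset.mul_sum]
    have : ∑ ij : Fin n × Fin n, Matrix.single ij.1 ij.2 (Y' ij.1 ij.2) = Y' := by
      conv_rhs => rw [Matrix.matrix_eq_sum_single Y']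
      exact Finset.sum_product' Finset.univ Finset.univ fun i j => Matrix.single i j (Y' i j)
    rw [this]
    simp [Y', ← mul_assoc]
  · obtain ⟨i, j⟩ := ij
    have e1 : ((t : GLC n) : MatC n) * ((P⁻¹ : GLC n) : MatC n) = ((P⁻¹ : GLC n) : MatC n) *
        Matrix.diagonal fun i => (((diagChar hP i).1 t : ℂˣ) : ℂ) := by
      rw [← diagonal_diagChar hP t, ← Units.val_mul, ← Units.val_mul]
      congr 1
      group
    have e2 : (P : MatC n) * (((t : GLC n)⁻¹ : GLC n) : MatC n) =
        (Matrix.diagonal fun i => (((diagChar hP i).1 t⁻¹ : ℂˣ) : ℂ)) * (P : MatC n) := by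
      rw [← diagonal_diagChar hP t⁻¹, ← Units.val_mul, ← Units.val_mul]
      congr 1
      rw [Subgroup.coe_inv]
      group
    dsimp only
    rw [← mul_assoc, ← mul_assoc, e1, mul_assoc _ (P : MatC n), e2, ← mul_assoc,
      mul_assoc ((P⁻¹ : GLC n) : MatC n), mul_assoc ((P⁻¹ : GLC n) : MatC n), ← smul_mul_assoc,
      ← mul_smul_comm]
    congr 2
    have : (((diagChar hP i * (diagChar hP j)⁻¹ : charLattice T).1 t : ℂˣ) : ℂ) =
      (((diagChar hP i).1 t : ℂˣ) : ℂ) * (((diagChar hP j).1 t⁻¹ : ℂˣ) : ℂ) := by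
      rw [map_inv]
      rfl
    rw [this]
    ext a b
    rw [Matrix.mul_diagonal, Matrix.diagonal_mul, Matrix.smul_apply, Matrix.single_apply]
    split_ifs with h
    · rw [h.1, h.2, smul_eq_mul]
      ring
    · simp

/-- A weight vector is the sum of its components of the same weight, so only the finitely many
weights `α i` occur on matrices. -/
lemma eq_of_weights {T : Subgroup (GLC n)} {α : Fin n × Fin n → charLattice T}
    (hα : ∀ Y : MatC n, ∃ Z : Fin n × Fin n → MatC n,
      Y = ∑ i, Z i ∧ ∀ (t : T) i, ((t : GLC n) : MatC n) * Z i * (((t : GLC n)⁻¹ : GLC n) : MatC n) =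
        (((α i).1 t : ℂˣ) : ℂ) • Z i) {β : charLattice T} {Y : MatC n} (hY : Y ≠ 0)
    (h : ∀ t : T, ((t : GLC n) : MatC n) * Y * (((t : GLC n)⁻¹ : GLC n) : MatC n) =
      ((β.1 t : ℂˣ) : ℂ) • Y) : ∃ i, α i = β := by
  classical
  obtain ⟨Z, hYZ, hZ⟩ := hα Y
  have h1 := eq_sum_filter_of_weight Finset.univ (fun i => (α i).1) Z β.1 Y fun t => by
    rw [← h t]
    conv_lhs => rw [hYZ, Finset.mul_sum, Finset.sum_mul]
    exact Finset.sum_congr rfl fun i _ => hZ t i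
  by_contra! hcon
  refine hY (h1.trans ?_)
  rw [Finset.filter_false_of_mem, Finset.sum_empty]
  exact fun i _ hi => hcon i (Subtype.ext hi)

lemma conj_pow (g : GLC n) (X : MatC n) (k : ℕ) :
    (g : MatC n) * X ^ k * ((g⁻¹ : GLC n) : MatC n) =
      ((g : MatC n) * X * ((g⁻¹ : GLC n) : MatC n)) ^ k := by
  induction k with
  | zero => simp
  | succ k ih => rw [pow_succ, pow_succ, ← ih]; simp [mul_assoc]

/-- The power `X^k` has weight `α^k`. These weights are distinct because `l` does not vanish on `α`,
but only finitely many can occur. -/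
lemma IsTorus.isNilpotent {G T : Subgroup (GLC n)} (hT : IsTorus T) {α : charLattice T}
    {l : Additive (charLattice T) →+ ℝ} (hl : l (Additive.ofMul α) ≠ 0) {X : MatC n}
    (hX : X ∈ rootSpace G T α) : IsNilpotent X := by
  obtain ⟨β, hβ⟩ := hT.exists_weights
  by_contra hcon
  have h1 : ∀ k : ℕ, ∃ i, β i = α ^ k := fun k => by
    refine eq_of_weights hβ (Y := X ^ k) (fun h => hcon ⟨k, h⟩) fun t => ?_
    rw [conj_pow, hX.2 t, smul_pow]
    rfl
  choose i hi using h1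
  refine not_injective_infinite_finite i fun a b hab => ?_
  have h2 : α ^ a = α ^ b := by rw [← hi, ← hi, hab]
  have h3 := congrArg (fun x => l (Additive.ofMul x)) h2
  simp only [ofMul_pow, map_nsmul, nsmul_eq_mul] at h3
  exact_mod_cast mul_right_cancel₀ hl h3

lemma adMat_conj (g : GLC n) (X Y : MatC n) :
    (g : MatC n) * adMat X Y * ((g⁻¹ : GLC n) : MatC n) =
      adMat ((g : MatC n) * X * ((g⁻¹ : GLC n) : MatC n))
        ((g : MatC n) * Y * ((g⁻¹ : GLC n) : MatC n)) := by
  simp only [adMat_apply, mul_sub, sub_mul]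
  simp [mul_assoc]

lemma adMat_smul (a b : ℂ) (X Y : MatC n) : adMat (a • X) (b • Y) = (a * b) • adMat X Y := by
  simp only [adMat_apply, smul_mul_smul_comm, smul_sub, mul_comm b a]

namespace CartanDecomposition

variable {G : Subgroup (GLC n)} (D : CartanDecomposition G)

/-- The decomposition of the Lie algebra into weight spaces of the torus. -/
lemma exists_root_decomposition (hG : IsZariskiClosed G) {Y : MatC n} (hY : Y ∈ lieAlg G) :
    ∃ (s : Finset (charLattice D.T)) (Z : charLattice D.T → MatC n),
      (∀ α, Z α ∈ rootSpace G D.T α) ∧ Y = ∑ α ∈ s, Z α := by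
  classical
  obtain ⟨α, hα⟩ := D.isTorus.exists_weights
  obtain ⟨Z, hYZ, hZ⟩ := hα Y
  refine ⟨Finset.univ.image α, fun χ => ∑ i with α i = χ, Z i, fun χ => ⟨?_, fun t => ?_⟩, ?_⟩
  -- In the quotient of all matrices by `Lie G` the translates of `Y` vanish, so by independence of
  -- characters each weight component of `Y` does.
  · have h1 := sum_filter_eq_zero_of_characters Finset.univ (fun i => (α i).1)
      (fun i => (lieSub G hG).mkQ (Z i)) (fun t => by
        simp only [← map_smul, ← hZ]
        rw [← map_sum, ← Finset.sum_mul, ← Finset.mul_sum, ← hYZ]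
        rw [Submodule.mkQ_apply, Submodule.Quotient.mk_eq_zero]
        exact conj_mem_lieAlg (D.T_le t.2) hY) χ.1
    rw [← map_sum, Submodule.mkQ_apply, Submodule.Quotient.mk_eq_zero] at h1
    have h2 : Finset.univ.filter (fun i => α i = χ) =
        Finset.univ.filter fun i => (α i).1 = χ.1 := by
      ext i
      simp only [Finset.mem_filter, Finset.mem_univ, true_and]
      exact Subtype.ext_iff
    dsimp only
    rw [h2]
    exact h1
  · rw [Finset.mul_sum, Finset.sum_mul, Finset.smul_sum]
    refine Finset.sum_congr rfl fun i hi => ?_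
    rw [hZ, (Finset.mem_filter.1 hi).2]
  · rw [hYZ]
    exact (Finset.sum_fiberwise_of_maps_to (fun i _ => Finset.mem_image_of_mem _
      (Finset.mem_univ i)) _).symm

/-- The negative of a root is a root. -/
theorem isRoot_inv (hG : IsConnectedReductive G) {α : charLattice D.T} (hα : IsRoot G D.T α) :
    IsRoot G D.T α⁻¹ := by
  classical
  obtain ⟨hα1, X, hX, hX0⟩ := hα
  obtain ⟨l, hl, -⟩ := D.isPositiveSystem
  have hnil : IsNilpotent X := D.isTorus.isNilpotent (hl α ⟨hα1, X, hX, hX0⟩) hX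
  -- The solution `Y` of `[X,[X,Y]] = X` stays one after projection to `Lie G` along a `G`-stable
  -- complement. In weight `α` only its component of weight `α⁻¹` contributes, so that component is
  -- nonzero.
  obtain ⟨Y, hY⟩ := exists_adMat_adMat_eq hnil
  obtain ⟨K, hK, hKst⟩ := hG.exists_isCompl (isRational_conjRep G) (K := lieSub G hG.closed)
    fun g w hw => by rw [conjRep_apply]; exact conj_mem_lieAlg g.2 hw
  have hadK : ∀ w ∈ K, adMat X w ∈ K := fun w hw => by
    have := dRep_mem (isRational_conjRep G) (X := ⟨X, hX.1⟩) fun s => hKst _ w hw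
    rwa [dRep_conjRep] at this
  have hadG : ∀ w ∈ lieSub G hG.closed, adMat X w ∈ lieSub G hG.closed := fun w hw => by
    have := dRep_mem (isRational_conjRep G) (X := ⟨X, hX.1⟩) (W := lieSub G hG.closed) (w := w)
      fun s => by rw [conjRep_apply]; exact conj_mem_lieAlg (expElt _ s).2 hw
    rwa [dRep_conjRep] at this
  obtain ⟨Y₁, hY₁, Y₂, hY₂, rfl⟩ := Submodule.mem_sup.1
    (hK.sup_eq_top ▸ Submodule.mem_top : Y ∈ lieSub G hG.closed ⊔ K)
  have h1 : adMat X (adMat X Y₁) = X := by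
    rw [map_add, map_add] at hY
    have h2 : X - adMat X (adMat X Y₁) = adMat X (adMat X Y₂) := by
      rw [sub_eq_iff_eq_add, add_comm, hY]
    have h3 : X - adMat X (adMat X Y₁) ∈ lieSub G hG.closed :=
      Submodule.sub_mem _ hX.1 (hadG _ (hadG _ hY₁))
    have h4 : X - adMat X (adMat X Y₁) ∈ K := h2 ▸ hadK _ (hadK _ hY₂)
    exact (sub_eq_zero.1 (Submodule.disjoint_def.1 hK.disjoint _ h3 h4)).symm
  obtain ⟨s, Z, hZ, hYZ⟩ := D.exists_root_decomposition hG.closed hY₁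
  have h2 := eq_sum_filter_of_weight s (fun β => (α * (α * β)).1)
    (fun β => adMat X (adMat X (Z β))) α.1 X fun t => by
      rw [← hX.2 t]
      conv_lhs => rw [← h1, hYZ, map_sum, map_sum, Finset.mul_sum, Finset.sum_mul]
      refine Finset.sum_congr rfl fun β _ => ?_
      rw [adMat_conj, adMat_conj, hX.2 t, (hZ β).2 t, adMat_smul, adMat_smul]
      rfl
  refine ⟨inv_ne_one.2 hα1, ?_⟩
  by_contra! hcon
  apply hX0
  rw [h2]
  refine Finset.sum_eq_zero fun β hβ => ?_
  have h3 : α * (α * β) = α := Subtype.ext (Finset.mem_filter.1 hβ).2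
  have h4 : β = α⁻¹ := by
    have : α * β = 1 := by simpa using h3
    exact eq_inv_of_mul_eq_one_right this
  rw [hcon (Z β) (h4 ▸ hZ β), map_zero, map_zero]

end CartanDecomposition

/-! ### Monomials in root vectors -/

lemma prod_ofFn_smul {A : Type*} [Ring A] [Algebra ℂ A] {N : ℕ} (c : Fin N → ℂ) (a : Fin N → A) :
    (List.ofFn fun i => c i • a i).prod = (∏ i, c i) • (List.ofFn a).prod := by
  simpa using (MultilinearMap.mkPiAlgebraFin ℂ N A).map_smul_univ c a

lemma prod_ofFn_sum {A : Type*} [Ring A] [Algebra ℂ A] {N : ℕ} (M : Fin N → ℕ)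
    (a : Fin N → ℕ → A) : (List.ofFn fun i => ∑ k ∈ Finset.range (M i), a i k).prod =
      ∑ m ∈ Fintype.piFinset fun i => Finset.range (M i), (List.ofFn fun i => a i (m i)).prod := by
  simpa using (MultilinearMap.mkPiAlgebraFin ℂ N A).map_sum_finset a fun i => Finset.range (M i)

lemma semiconjBy_list_prod {A ι : Type*} [Monoid A] {a : A} {x y : ι → A}
    (h : ∀ i, SemiconjBy a (x i) (y i)) (l : List ι) :
    SemiconjBy a (l.map x).prod (l.map y).prod := by
  induction l with
  | nil => simp
  | cons i l ih => simpa using (h i).mul_right ih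

section HighestWeight

variable {G : Subgroup (GLC n)} {D : CartanDecomposition G} {V : Type*} [AddCommGroup V]
  [Module ℂ V] [FiniteDimensional ℂ V] {ρ : Representation ℂ G V}

/-- The product of exponentials as an element of `G`. -/
def prodElt (f : D.RootVectors) {N : ℕ} (S : Fin N → D.pos) (z : Fin N → ℂ) : G :=
  (List.ofFn fun i => expElt (f.lie (S i)) (z i)).prod

lemma coe_prodElt (f : D.RootVectors) {N : ℕ} (S : Fin N → D.pos) (z : Fin N → ℂ) :
    ((prodElt f S z : G) : GLC n) = (CartanDecomposition.prodMap f S z : D.Uminus) := by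
  change G.subtype _ = D.Uminus.subtype _
  rw [prodElt, CartanDecomposition.prodMap, map_list_prod, map_list_prod, List.map_ofFn,
    List.map_ofFn]
  rfl

lemma CartanDecomposition.RootVectors.isNilpotent (f : D.RootVectors) (β : D.pos) :
    IsNilpotent (f.lie β).1 := by
  obtain ⟨l, -, hpos⟩ := D.isPositiveSystem
  have hβ := hpos.subset β.2
  refine D.isTorus.isNilpotent (l := l) (α := (β : charLattice D.T)⁻¹) ?_ (f.mem β)
  rw [ofMul_inv, map_neg]
  exact neg_ne_zero.2 hβ.2.ne'

/-- The action of a product of exponentials, expanded in monomials. -/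
lemma rep_prodElt (hρ : IsRational ρ) (f : D.RootVectors) {N : ℕ} (S : Fin N → D.pos) :
    ∃ B : Finset (Fin N → ℕ), (∀ m, m ∉ B → monomialOp f S ρ m = 0) ∧
      ∀ z, ρ (prodElt f S z) = ∑ m ∈ B, (∏ i, z i ^ m i) • monomialOp f S ρ m := by
  choose M hM0 hM using fun i => rep_expElt_of_isNilpotent hρ (f.isNilpotent (S i))
  refine ⟨Fintype.piFinset fun i => Finset.range (M i), fun m hm => ?_, fun z => ?_⟩
  · obtain ⟨i, hi⟩ : ∃ i, M i ≤ m i := by simpa [Fintype.mem_piFinset] using hm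
    refine List.prod_eq_zero (List.mem_ofFn.2 ⟨i, ?_⟩)
    rw [hM0 i _ hi, smul_zero]
  · rw [prodElt, map_list_prod, List.map_ofFn]
    have : (ρ ∘ fun i => expElt (f.lie (S i)) (z i)) = fun i => ∑ k ∈ Finset.range (M i),
        z i ^ k • ((k.factorial : ℂ)⁻¹ • dRep ρ (f.lie (S i)) ^ k) := funext fun i => hM i _
    rw [this, prod_ofFn_sum]
    refine Finset.sum_congr rfl fun m _ => ?_
    rw [prod_ofFn_smul]
    rfl

/-- The weight `χ - ∑ mᵢ βᵢ`. -/
def monomialWeight (χ : charLattice D.T) {N : ℕ} (S : Fin N → D.pos) (m : Fin N → ℕ) :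
    charLattice D.T := χ * ∏ i, ((S i : charLattice D.T)⁻¹) ^ m i

/-- The functional that defines the positive system is positive on every `βᵢ`. -/
lemma eq_zero_of_monomialWeight_eq {χ : charLattice D.T} {N : ℕ} {S : Fin N → D.pos}
    {m : Fin N → ℕ} (h : monomialWeight χ S m = χ) : m = 0 := by
  obtain ⟨l, -, hpos⟩ := D.isPositiveSystem
  have hS : ∀ i, 0 < l (Additive.ofMul (S i : charLattice D.T)) := fun i =>
    (hpos.subset (S i).2).2
  have h1 : ∏ i, ((S i : charLattice D.T)⁻¹) ^ m i = 1 := mul_eq_left.1 h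
  have h2 := congrArg (fun x => l (Additive.ofMul x)) h1
  simp only [ofMul_prod, map_sum, ofMul_pow, map_nsmul, ofMul_inv, map_neg, ofMul_one, map_zero,
    smul_neg, Finset.sum_neg_distrib, neg_eq_zero] at h2
  rw [Finset.sum_eq_zero_iff_of_nonneg fun i _ => nsmul_nonneg (hS i).le _] at h2
  funext i
  have := h2 i (Finset.mem_univ i)
  rw [nsmul_eq_mul, mul_eq_zero] at this
  exact_mod_cast this.resolve_right (hS i).ne'

/-- `x` is fixed by `U` and has weight `χ`. -/
structure IsPrimitiveVector (D : CartanDecomposition G) (ρ : Representation ℂ G V)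
    (χ : charLattice D.T) (x : V) : Prop where
  weight : ∀ (g : G) (hg : (g : GLC n) ∈ D.T), ρ g x = ((χ.1 ⟨g, hg⟩ : ℂˣ) : ℂ) • x
  unipotent : ∀ g : G, (g : GLC n) ∈ D.U → ρ g x = x

/-- Conjugation by `t` scales each `f_β` by `β(t)⁻¹`; moving `t` through the monomial collects these
scalars. -/
lemma rep_monomialOp (hρ : IsRational ρ) (f : D.RootVectors) {N : ℕ} (S : Fin N → D.pos)
    {χ : charLattice D.T} {x : V} (hx : IsPrimitiveVector D ρ χ x) (m : Fin N → ℕ) (t : D.T) :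
    ρ ⟨t, D.T_le t.2⟩ (monomialOp f S ρ m x) =
      (((monomialWeight χ S m).1 t : ℂˣ) : ℂ) • monomialOp f S ρ m x := by
  obtain ⟨L, hL⟩ := exists_linear_dRep hρ
  set g : G := ⟨t, D.T_le t.2⟩ with hg
  let c : Fin N → ℂ := fun i => (((S i : charLattice D.T)⁻¹.1 t : ℂˣ) : ℂ)
  have hd : ∀ i, SemiconjBy (ρ g) (dRep ρ (f.lie (S i))) (c i • dRep ρ (f.lie (S i))) := by
    intro i
    ext1 w
    rw [Module.End.mul_apply, ← dRep_conj hρ g (f.lie (S i)) w, hL, hL, Module.End.mul_apply]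
    have : ((g : GLC n) : MatC n) * (f.lie (S i)).1 * (((g : GLC n)⁻¹ : GLC n) : MatC n) =
        c i • (f.lie (S i)).1 := (f.mem (S i)).2 t
    refine Eq.trans (congrArg (fun Z => L Z (ρ g w)) this) ?_
    rw [map_smul]
  have hmon : SemiconjBy (ρ g) (monomialOp f S ρ m) ((∏ i, c i ^ m i) • monomialOp f S ρ m) := by
    rw [monomialOp, ← prod_ofFn_smul, List.ofFn_eq_map, List.ofFn_eq_map]
    refine semiconjBy_list_prod (fun i => ?_) _
    have h1 := (hd i).pow_right (m i)
    rw [smul_pow] at h1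
    rw [smul_comm, SemiconjBy, mul_smul_comm, h1.eq, smul_mul_assoc]
    rfl
  have h1 := LinearMap.congr_fun hmon.eq x
  rw [Module.End.mul_apply, Module.End.mul_apply, hx.weight g t.2, map_smul] at h1
  rw [h1, LinearMap.smul_apply, smul_smul]
  congr 1
  have : (monomialWeight χ S m).1 = χ.1 * ∏ i, ((S i : charLattice D.T)⁻¹.1) ^ m i := by
    rw [monomialWeight, Subgroup.coe_mul, Subgroup.val_finsetProd]
    rfl
  rw [this, MonoidHom.mul_apply, MonoidHom.finsetProd_apply, Units.val_mul, Units.coe_prod]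
  rfl

/-- The span of the `U⁻`-orbit of a primitive vector is stable under `G`. -/
theorem rep_mem_span_Uminus (hG : IsConnectedReductive G) (hρ : IsRational ρ)
    {χ : charLattice D.T} {x : V} (hx : IsPrimitiveVector D ρ χ x) (g : G) :
    ρ g x ∈ Submodule.span ℂ {w | ∃ u : G, (u : GLC n) ∈ D.Uminus ∧ w = ρ u x} := by
  set W := Submodule.span ℂ {w | ∃ u : G, (u : GLC n) ∈ D.Uminus ∧ w = ρ u x} with hW
  obtain ⟨L, hL⟩ := exists_linear_dRep hρ
  obtain ⟨l, hl, hpos⟩ := D.isPositiveSystem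
  have hmem : ∀ u : G, (u : GLC n) ∈ D.Uminus → ρ u x ∈ W := fun u hu =>
    Submodule.subset_span ⟨u, hu, rfl⟩
  have hxW : x ∈ W := by simpa using hmem 1 D.Uminus.one_mem
  have hst : ∀ u : G, (u : GLC n) ∈ D.Uminus → ∀ w ∈ W, ρ u w ∈ W := by
    intro u hu w hw
    induction hw using Submodule.span_induction with
    | mem w hw =>
      obtain ⟨v, hv, rfl⟩ := hw
      rw [← Module.End.mul_apply, ← map_mul]
      exact hmem _ (D.Uminus.mul_mem hu hv)
    | zero => simp
    | add a b _ _ ha hb => rw [map_add]; exact W.add_mem ha hb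
    | smul c a _ ha => rw [map_smul]; exact W.smul_mem c ha
  -- It suffices to follow the curve `exp (sZ) x`: it lies on the line of `x` in weight zero, in the
  -- `U⁻`-orbit for a negative root, and is constant for a positive one.
  have hroot : ∀ (α : charLattice D.T) (Z : MatC n), Z ∈ rootSpace G D.T α → L Z x ∈ W := by
    intro α Z hZ
    by_cases hZ0 : Z = 0
    · rw [hZ0, map_zero]; exact W.zero_mem
    rw [show Z = (⟨Z, hZ.1⟩ : lieAlg G).1 from rfl, ← hL]
    refine dRep_mem hρ fun s => ?_
    by_cases hα : α = 1
    · rw [hα, D.zero_weight] at hZ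
      rw [hx.weight _ (hZ s)]
      exact W.smul_mem _ hxW
    have hr : IsRoot G D.T α := ⟨hα, Z, hZ, hZ0⟩
    rcases lt_or_gt_of_ne (hl α hr) with h | h
    · refine hmem _ (Subgroup.subset_closure ⟨α⁻¹, ?_, Z, by rwa [inv_inv], s, rfl⟩)
      rw [hpos]
      refine ⟨D.isRoot_inv hG hr, ?_⟩
      rw [ofMul_inv, map_neg]
      exact neg_pos.2 h
    · have : α ∈ D.pos := by rw [hpos]; exact ⟨hr, h⟩
      rw [hx.unipotent _ (Subgroup.subset_closure ⟨α, this, Z, hZ, s, rfl⟩)]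
      exact hxW
  have hlie : ∀ Y : lieAlg G, dRep ρ Y x ∈ W := by
    intro Y
    obtain ⟨s, Z, hZ, hYZ⟩ := D.exists_root_decomposition hG.closed Y.2
    rw [hL, hYZ, map_sum, LinearMap.sum_apply]
    exact W.sum_mem fun α _ => hroot α _ (hZ α)
  refine mem_of_dRep_mem hG.closed hG.connected hρ (fun Y w hw => ?_) g hxW
  induction hw using Submodule.span_induction with
  | mem w hw =>
    obtain ⟨u, hu, rfl⟩ := hw
    -- `Y u x = u (u⁻¹ Y u) x`, which reduces stability to the vector `x` itself.
    have hY := conj_mem_lieAlg (G.inv_mem u.2) Y.2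
    have h1 := dRep_conj hρ u ⟨_, hY⟩ x
    have h2 : ((u : GLC n) : MatC n) * ((((u : GLC n)⁻¹ : GLC n) : MatC n) * Y.1 *
        ((((u : GLC n)⁻¹)⁻¹ : GLC n) : MatC n)) * (((u : GLC n)⁻¹ : GLC n) : MatC n) = Y.1 := by
      simp [← mul_assoc]
    have h3 : dRep ρ Y (ρ u x) = ρ u (dRep ρ ⟨_, hY⟩ x) := by
      rw [← h1]
      congr 2
      exact Subtype.ext h2.symm
    rw [h3]
    exact hst u hu _ (hlie _)
  | zero => simp
  | add a b _ _ ha hb => rw [map_add]; exact W.add_mem ha hb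
  | smul c a _ ha => rw [map_smul]; exact W.smul_mem c ha

/-- For a birational sequence the monomials generate the `G`-span of a primitive vector. -/
theorem rep_mem_span_monomialOp (hG : IsConnectedReductive G) (hρ : IsRational ρ)
    {χ : charLattice D.T} {x : V} (hx : IsPrimitiveVector D ρ χ x) {f : D.RootVectors} {N : ℕ}
    {S : Fin N → D.pos} (hS : CartanDecomposition.IsBirationalSequence f S) (g : G) :
    ρ g x ∈ Submodule.span ℂ (Set.range fun m => monomialOp f S ρ m x) := by
  refine mem_of_dual _ fun ξ hξ => ?_
  obtain ⟨P, hP⟩ := hρ.exists_poly ξ x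
  obtain ⟨B, -, hB⟩ := rep_prodElt hρ f S
  -- The function `u ↦ ξ (u x)` on `U⁻` vanishes on the image of the product map, since `ξ` kills
  -- all monomials.
  have h1 := hS.dominant (fun u => ev (u : GLC n) P) (mem_coordRing_iff.2 ⟨P, fun _ => rfl⟩)
    fun z => by
      rw [← coe_prodElt, ← hP, hB, LinearMap.sum_apply, map_sum]
      refine Finset.sum_eq_zero fun m _ => ?_
      rw [LinearMap.smul_apply, map_smul, hξ _ (Submodule.subset_span ⟨m, rfl⟩), smul_zero]
  have h2 : Submodule.span ℂ {w | ∃ u : G, (u : GLC n) ∈ D.Uminus ∧ w = ρ u x} ≤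
      LinearMap.ker ξ := by
    refine Submodule.span_le.2 ?_
    rintro _ ⟨u, hu, rfl⟩
    rw [SetLike.mem_coe, LinearMap.mem_ker, hP]
    exact congrFun h1 ⟨u, hu⟩
  exact h2 (rep_mem_span_Uminus hG hρ hx g)

lemma monomialOp_zero (f : D.RootVectors) {N : ℕ} (S : Fin N → D.pos) :
    monomialOp f S ρ 0 = 1 := by
  simp [monomialOp]

/-- The highest weight space is a line. -/
theorem mem_span_singleton_of_weight (hG : IsConnectedReductive G) (hρ : IsRational ρ)
    {χ : charLattice D.T} {x : V} (hx : IsPrimitiveVector D ρ χ x) {f : D.RootVectors} {N : ℕ}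
    {S : Fin N → D.pos} (hS : CartanDecomposition.IsBirationalSequence f S) {w : V}
    (hw : w ∈ Submodule.span ℂ (Set.range fun g => ρ g x))
    (hwt : ∀ t : D.T, ρ ⟨t, D.T_le t.2⟩ w = ((χ.1 t : ℂˣ) : ℂ) • w) :
    w ∈ Submodule.span ℂ {x} := by
  classical
  have hw' : w ∈ Submodule.span ℂ (Set.range fun m => monomialOp f S ρ m x) := by
    refine Submodule.span_le.2 ?_ hw
    rintro _ ⟨g, rfl⟩
    exact rep_mem_span_monomialOp hG hρ hx hS g
  obtain ⟨c, rfl⟩ := Finsupp.mem_span_range_iff_exists_finsupp.1 hw'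
  -- Comparison of weights leaves only the monomial with exponent zero.
  have h1 := eq_sum_filter_of_weight c.support (fun m => (monomialWeight χ S m).1)
    (fun m => c m • monomialOp f S ρ m x) χ.1 _ fun t => by
      rw [← hwt t, Finsupp.sum, map_sum]
      refine Finset.sum_congr rfl fun m _ => ?_
      rw [map_smul, rep_monomialOp hρ f S hx, smul_comm]
  rw [h1]
  refine Submodule.sum_mem _ fun m hm => ?_
  rw [eq_zero_of_monomialWeight_eq (Subtype.ext (Finset.mem_filter.1 hm).2), monomialOp_zero]
  exact Submodule.smul_mem _ _ (Submodule.mem_span_singleton_self x)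

end HighestWeight

/-! ### Products of matrix coefficients -/

section Product

open scoped TensorProduct

variable {G : Subgroup (GLC n)} {V₁ V₂ V₃ : Type*}
    [AddCommGroup V₁] [Module ℂ V₁] [FiniteDimensional ℂ V₁]
    [AddCommGroup V₂] [Module ℂ V₂] [FiniteDimensional ℂ V₂]
    [AddCommGroup V₃] [Module ℂ V₃] [FiniteDimensional ℂ V₃]
    {ρ₁ : Representation ℂ G V₁} {ρ₂ : Representation ℂ G V₂} {ρ₃ : Representation ℂ G V₃}

lemma IsRational.tprod (h₁ : IsRational ρ₁) (h₂ : IsRational ρ₂) : IsRational (ρ₁.tprod ρ₂) := by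
  intro φ v
  induction v using TensorProduct.induction_on with
  | zero =>
    simp only [map_zero]
    exact (coordRing G).zero_mem
  | tmul a b =>
    let b₁ := Module.finBasis ℂ V₁
    let b₂ := Module.finBasis ℂ V₂
    have : (fun g => φ (ρ₁.tprod ρ₂ g (a ⊗ₜ b))) = ∑ i, ∑ j, φ (b₁ i ⊗ₜ b₂ j) •
        ((fun g => b₁.coord i (ρ₁ g a)) * fun g => b₂.coord j (ρ₂ g b)) := by
      funext g
      rw [Representation.tprod_apply, TensorProduct.map_tmul]
      conv_lhs => rw [← b₁.sum_repr (ρ₁ g a), ← b₂.sum_repr (ρ₂ g b)]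
      simp only [TensorProduct.sum_tmul, TensorProduct.tmul_sum, TensorProduct.smul_tmul_smul,
        map_sum, map_smul, Finset.sum_apply, Pi.smul_apply, Pi.mul_apply, smul_eq_mul,
        Module.Basis.coord_apply]
      rw [Finset.sum_comm]
      exact Finset.sum_congr rfl fun i _ => Finset.sum_congr rfl fun j _ => mul_comm _ _
    rw [this]
    exact (coordRing G).sum_mem fun i _ => (coordRing G).sum_mem fun j _ =>
      (coordRing G).smul_mem ((coordRing G).mul_mem (h₁ _ _) (h₂ _ _)) _
  | add a b ha hb =>
    simp only [map_add]
    exact (coordRing G).add_mem ha hb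

omit [FiniteDimensional ℂ V₁] [FiniteDimensional ℂ V₂] in
lemma IsRational.prod (h₁ : IsRational ρ₁) (h₂ : IsRational ρ₂) : IsRational (ρ₁.prod ρ₂) := by
  rintro φ ⟨a, b⟩
  have : (fun g => φ (ρ₁.prod ρ₂ g (a, b))) =
      (fun g => (φ.comp (LinearMap.inl ℂ V₁ V₂)) (ρ₁ g a)) +
        fun g => (φ.comp (LinearMap.inr ℂ V₁ V₂)) (ρ₂ g b) := by
    funext g
    rw [Pi.add_apply, LinearMap.comp_apply, LinearMap.comp_apply, ← map_add]
    congr 1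
    simp [Representation.prod]
  rw [this]
  exact (coordRing G).add_mem (h₁ _ _) (h₂ _ _)

/-- Matrix coefficients for highest weight vectors of weights `χ₁`, `χ₂` multiply to those of
weight `χ₁ χ₂`. -/
theorem exists_dual_mul (hG : IsConnectedReductive G) {D : CartanDecomposition G}
    {f : D.RootVectors} {N : ℕ} {S : Fin N → D.pos}
    (hS : CartanDecomposition.IsBirationalSequence f S)
    (r₁ : IsRational ρ₁) (r₂ : IsRational ρ₂) (r₃ : IsRational ρ₃)
    {χ₁ χ₂ : charLattice D.T} {v₁ : V₁} {v₂ : V₂} {v₃ : V₃}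
    (h₁ : IsPrimitiveVector D ρ₁ χ₁ v₁) (h₂ : IsPrimitiveVector D ρ₂ χ₂ v₂)
    (h₃ : IsPrimitiveVector D ρ₃ (χ₁ * χ₂) v₃) (hv₃ : v₃ ≠ 0)
    (ξ : Module.Dual ℂ V₁) (η : Module.Dual ℂ V₂) :
    ∃ ζ : Module.Dual ℂ V₃, ∀ g, ζ (ρ₃ g v₃) = ξ (ρ₁ g v₁) * η (ρ₂ g v₂) := by
  -- The `G`-span `M` of `x` is to be the graph of a map sending `g v₃` to `g (v₁ ⊗ v₂)`. For this
  -- the kernel `K` of its projection to `V₃` must be zero.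
  let ρ := (ρ₁.tprod ρ₂).prod ρ₃
  have hρ : IsRational ρ := (r₁.tprod r₂).prod r₃
  let x : (V₁ ⊗[ℂ] V₂) × V₃ := (v₁ ⊗ₜ v₂, v₃)
  have happ : ∀ g (w : (V₁ ⊗[ℂ] V₂) × V₃), ρ g w = (ρ₁.tprod ρ₂ g w.1, ρ₃ g w.2) :=
    fun _ _ => rfl
  have hgx : ∀ g, ρ g x = (ρ₁ g v₁ ⊗ₜ ρ₂ g v₂, ρ₃ g v₃) := fun g => by
    rw [happ, Representation.tprod_apply, TensorProduct.map_tmul]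
  have hx : IsPrimitiveVector D ρ (χ₁ * χ₂) x :=
    { weight := fun g hg => by
        rw [hgx, h₁.weight g hg, h₂.weight g hg, h₃.weight g hg, TensorProduct.smul_tmul_smul]
        rfl
      unipotent := fun g hg => by
        rw [hgx, h₁.unipotent g hg, h₂.unipotent g hg, h₃.unipotent g hg] }
  let M := Submodule.span ℂ (Set.range fun g => ρ g x)
  have hM : ∀ g, ∀ w ∈ M, ρ g w ∈ M := by
    intro g w hw
    induction hw using Submodule.span_induction with
    | mem w hw =>
      obtain ⟨k, rfl⟩ := hw
      dsimp only
      rw [← Module.End.mul_apply, ← map_mul]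
      exact Submodule.subset_span ⟨_, rfl⟩
    | zero => simp
    | add a b _ _ ha hb => rw [map_add]; exact M.add_mem ha hb
    | smul c a _ ha => rw [map_smul]; exact M.smul_mem c ha
  let K := M ⊓ LinearMap.ker (LinearMap.snd ℂ (V₁ ⊗[ℂ] V₂) V₃)
  have hK : ∀ g, ∀ w ∈ K, ρ g w ∈ K := fun g w hw => ⟨hM g w hw.1, by
    have : w.2 = 0 := hw.2
    change (ρ g w).2 = 0
    rw [happ, this, map_zero]⟩
  obtain ⟨K', hKK', hK'⟩ := hG.exists_isCompl hρ hK
  -- The component of `x` along `K` lies in `M` and has the weight of `x`, so it is `c x`. Its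
  -- second coordinate `c v₃` is zero, hence `c = 0`.
  have hxK' : x ∈ K' := by
    obtain ⟨k, hk, k', hk', hkk'⟩ := Submodule.mem_sup.1
      (hKK'.sup_eq_top ▸ Submodule.mem_top : x ∈ K ⊔ K')
    have hkw : ∀ t : D.T, ρ ⟨t, D.T_le t.2⟩ k = (((χ₁ * χ₂).1 t : ℂˣ) : ℂ) • k := by
      intro t
      have h1 := hx.weight ⟨t, D.T_le t.2⟩ t.2
      rw [← hkk', map_add, smul_add] at h1
      have h2 : ρ ⟨t, D.T_le t.2⟩ k - (((χ₁ * χ₂).1 t : ℂˣ) : ℂ) • k =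
          (((χ₁ * χ₂).1 t : ℂˣ) : ℂ) • k' - ρ ⟨t, D.T_le t.2⟩ k' :=
        sub_eq_sub_iff_add_eq_add.2 (h1.trans (add_comm _ _))
      refine sub_eq_zero.1 (Submodule.disjoint_def.1 hKK'.disjoint _
        (K.sub_mem (hK _ _ hk) (K.smul_mem _ hk)) ?_)
      rw [h2]
      exact K'.sub_mem (K'.smul_mem _ hk') (hK' _ _ hk')
    obtain ⟨c, rfl⟩ := Submodule.mem_span_singleton.1
      (mem_span_singleton_of_weight hG hρ hx hS hk.1 hkw)
    have h3 : c • v₃ = 0 := hk.2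
    rw [(smul_eq_zero.1 h3).resolve_right hv₃, zero_smul, zero_add] at hkk'
    exact hkk' ▸ hk'
  have hMK' : M ≤ K' := by
    refine Submodule.span_le.2 ?_
    rintro _ ⟨g, rfl⟩
    exact hK' g x hxK'
  have hinj : LinearMap.ker ((LinearMap.snd ℂ (V₁ ⊗[ℂ] V₂) V₃).comp M.subtype) = ⊥ := by
    rw [LinearMap.ker_eq_bot']
    intro w hw
    exact Subtype.ext (Submodule.disjoint_def.1 hKK'.disjoint w.1 ⟨w.2, hw⟩ (hMK' w.2))
  obtain ⟨σ, hσ⟩ := LinearMap.exists_leftInverse_of_injective _ hinj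
  refine ⟨(TensorProduct.lift ((LinearMap.mul ℂ ℂ).compl₁₂ ξ η)).comp
    ((LinearMap.fst ℂ (V₁ ⊗[ℂ] V₂) V₃).comp (M.subtype.comp σ)), fun g => ?_⟩
  have h4 := LinearMap.congr_fun hσ ⟨ρ g x, Submodule.subset_span ⟨g, rfl⟩⟩
  have h5 : σ (ρ₃ g v₃) = ⟨ρ g x, Submodule.subset_span ⟨g, rfl⟩⟩ := h4
  rw [LinearMap.comp_apply, LinearMap.comp_apply, LinearMap.comp_apply, h5]
  change TensorProduct.lift ((LinearMap.mul ℂ ℂ).compl₁₂ ξ η) (ρ g x).1 = _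
  rw [hgx, TensorProduct.lift.tmul]
  rfl

end Product

/-! ### Monomial orders -/

/-- Strict monomial orders on `ℕ^N`. -/
structure IsMonomialOrder {N : ℕ} (lt : (Fin N → ℕ) → (Fin N → ℕ) → Prop) : Prop where
  irrefl : ∀ a, ¬ lt a a
  trans : ∀ a b c, lt a b → lt b c → lt a c
  total : ∀ a b, lt a b ∨ a = b ∨ lt b a
  add : ∀ a b c, lt a b → lt (a + c) (b + c)
  pos : ∀ a, a ≠ 0 → lt 0 a

section Orders

variable {N : ℕ}

lemma piLex_irrefl (s : Fin N → Fin N → Prop) (a : Fin N → ℕ) :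
    ¬ Pi.Lex s (· < ·) a a := fun ⟨_, _, h⟩ => lt_irrefl _ h

lemma piLex_trans {s : Fin N → Fin N → Prop} [IsStrictTotalOrder (Fin N) s] {a b c : Fin N → ℕ}
    (hab : Pi.Lex s (· < ·) a b) (hbc : Pi.Lex s (· < ·) b c) :
    Pi.Lex s (· < ·) a c := by
  obtain ⟨i, hi, hi'⟩ := hab
  obtain ⟨j, hj, hj'⟩ := hbc
  rcases trichotomous_of s i j with h | rfl | h
  · exact ⟨i, fun k hk => (hi k hk).trans (hj k (trans_of s hk h)), (hj i h) ▸ hi'⟩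
  · exact ⟨i, fun k hk => (hi k hk).trans (hj k hk), lt_trans hi' hj'⟩
  · exact ⟨j, fun k hk => (hi k (trans_of s hk h)).trans (hj k hk), (hi j h) ▸ hj'⟩

lemma piLex_total {s : Fin N → Fin N → Prop} [IsStrictTotalOrder (Fin N) s] (a b : Fin N → ℕ) :
    Pi.Lex s (· < ·) a b ∨ a = b ∨ Pi.Lex s (· < ·) b a := by
  by_cases hab : a = b
  · exact Or.inr (Or.inl hab)
  have hwf : WellFounded s := Finite.wellFounded_of_trans_of_irrefl s
  obtain ⟨i, hi, hmin⟩ := hwf.has_min {i | a i ≠ b i} (Function.ne_iff.1 hab)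
  have heq : ∀ j, s j i → a j = b j := fun j hj => by
    by_contra h
    exact hmin j h hj
  rcases lt_or_gt_of_ne hi with h | h
  · exact Or.inl ⟨i, heq, h⟩
  · exact Or.inr (Or.inr ⟨i, fun j hj => (heq j hj).symm, h⟩)

lemma piLex_add {s : Fin N → Fin N → Prop} {a b : Fin N → ℕ} (c : Fin N → ℕ)
    (hab : Pi.Lex s (· < ·) a b) : Pi.Lex s (· < ·) (a + c) (b + c) := by
  obtain ⟨i, hi, hi'⟩ := hab
  exact ⟨i, fun j hj => by simp [hi j hj], by simpa using hi'⟩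

lemma piLex_pos {s : Fin N → Fin N → Prop} [IsStrictTotalOrder (Fin N) s] {a : Fin N → ℕ}
    (ha : a ≠ 0) : Pi.Lex s (· < ·) 0 a := by
  rcases piLex_total (s := s) 0 a with h | h | ⟨i, _, h⟩
  · exact h
  · exact absurd h.symm ha
  · exact absurd h (Nat.not_lt_zero _)

lemma wtVal_add (Ψ : (Fin N → ℤ) →ₗ[ℤ] ℤ) (a b : Fin N → ℕ) :
    wtVal Ψ (a + b) = wtVal Ψ a + wtVal Ψ b := by
  rw [wtVal, wtVal, wtVal, ← map_add]
  congr 1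

/-- Positivity may come from `Ψ` or from the tie-breaking relation; for the opposite orders only `Ψ`
can supply it. -/
lemma Refines.isMonomialOrder {Ψ : (Fin N → ℤ) →ₗ[ℤ] ℤ} {r lt : (Fin N → ℕ) → (Fin N → ℕ) → Prop}
    (h : Refines Ψ r lt) (hΨ : ∀ a, 0 ≤ wtVal Ψ a) (irrefl : ∀ a, ¬ r a a)
    (trans : ∀ a b c, r a b → r b c → r a c) (total : ∀ a b, r a b ∨ a = b ∨ r b a)
    (add : ∀ a b c, r a b → r (a + c) (b + c)) (pos : ∀ a, a ≠ 0 → 0 < wtVal Ψ a ∨ r 0 a) :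
    IsMonomialOrder lt where
  irrefl a ha := by
    rcases (h a a).1 ha with h | ⟨-, h⟩
    · exact lt_irrefl _ h
    · exact irrefl a h
  trans a b c hab hbc := by
    rw [h] at *
    rcases hab with h1 | ⟨h1, h1'⟩ <;> rcases hbc with h2 | ⟨h2, h2'⟩
    · exact Or.inl (h1.trans h2)
    · exact Or.inl (h2 ▸ h1)
    · exact Or.inl (h1 ▸ h2)
    · exact Or.inr ⟨h1.trans h2, trans a b c h1' h2'⟩
  total a b := by
    rw [h, h]
    rcases lt_trichotomy (wtVal Ψ a) (wtVal Ψ b) with h1 | h1 | h1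
    · exact Or.inl (Or.inl h1)
    · rcases total a b with h2 | h2 | h2
      · exact Or.inl (Or.inr ⟨h1, h2⟩)
      · exact Or.inr (Or.inl h2)
      · exact Or.inr (Or.inr (Or.inr ⟨h1.symm, h2⟩))
    · exact Or.inr (Or.inr (Or.inl h1))
  add a b c hab := by
    rw [h] at *
    rw [wtVal_add, wtVal_add]
    rcases hab with h1 | ⟨h1, h1'⟩
    · exact Or.inl (by omega)
    · exact Or.inr ⟨by omega, add a b c h1'⟩
  pos a ha := by
    have h0 : wtVal Ψ 0 = 0 := by
      have := wtVal_add Ψ 0 0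
      rw [add_zero] at this
      omega
    rw [h, h0]
    rcases pos a ha with h1 | h1
    · exact Or.inl h1
    · rcases (hΨ a).lt_or_eq with h2 | h2
      · exact Or.inl h2
      · exact Or.inr ⟨h2, h1⟩

lemma IsWeightedLexOrder.isMonomialOrder {lt : (Fin N → ℕ) → (Fin N → ℕ) → Prop}
    (h : IsWeightedLexOrder lt) : IsMonomialOrder lt := by
  obtain ⟨Ψ, hΨ, h | h | ⟨hpos, h | h⟩⟩ := h
  -- `lexLT` and `rlexLT` unfold to `Pi.Lex` for the relations `<` and `>` on the indices.
  · exact h.isMonomialOrder hΨ (piLex_irrefl (· < ·)) (fun _ _ _ => piLex_trans (s := (· < ·)))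
      (piLex_total (s := (· < ·))) (fun _ _ => piLex_add (s := (· < ·)))
      fun a ha => Or.inr (piLex_pos (s := (· < ·)) ha)
  · exact h.isMonomialOrder hΨ (piLex_irrefl (· > ·)) (fun _ _ _ => piLex_trans (s := (· > ·)))
      (piLex_total (s := (· > ·))) (fun _ _ => piLex_add (s := (· > ·)))
      fun a ha => Or.inr (piLex_pos (s := (· > ·)) ha)
  · exact h.isMonomialOrder hΨ (piLex_irrefl (· < ·))
      (fun _ _ _ h1 h2 => piLex_trans (s := (· < ·)) h2 h1)
      (fun a b => (piLex_total (s := (· < ·)) b a).imp_right (Or.imp_left Eq.symm))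
      (fun _ _ => piLex_add (s := (· < ·))) fun a ha => Or.inl (hpos a ha)
  · exact h.isMonomialOrder hΨ (piLex_irrefl (· > ·))
      (fun _ _ _ h1 h2 => piLex_trans (s := (· > ·)) h2 h1)
      (fun a b => (piLex_total (s := (· > ·)) b a).imp_right (Or.imp_left Eq.symm))
      (fun _ _ => piLex_add (s := (· > ·))) fun a ha => Or.inl (hpos a ha)

variable {lt : (Fin N → ℕ) → (Fin N → ℕ) → Prop}

/-- Dickson's lemma: a descending sequence has a later term that dominates an earlier one
componentwise, and a monomial order extends the componentwise order. -/
lemma IsMonomialOrder.wellFounded (h : IsMonomialOrder lt) : WellFounded lt := by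
  have : IsTrans _ lt := ⟨h.trans⟩
  have : Std.Irrefl lt := ⟨h.irrefl⟩
  have : IsStrictOrder _ lt := {}
  rw [RelEmbedding.wellFounded_iff_isEmpty]
  refine ⟨fun F => ?_⟩
  obtain ⟨i, j, hij, hle⟩ := wellQuasiOrdered_le (α := Fin N → ℕ) F
  have h1 : lt (F j) (F i) := F.map_rel_iff.2 hij
  obtain ⟨c, hc⟩ := exists_add_of_le hle
  rcases eq_or_ne c 0 with rfl | hc0
  · rw [add_zero] at hc
    exact h.irrefl _ (hc ▸ h1)
  · have h2 := h.add 0 c (F i) (h.pos c hc0)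
    rw [zero_add, add_comm, ← hc] at h2
    exact h.irrefl _ (h.trans _ _ _ h1 h2)

lemma IsMonomialOrder.add_lt_add (h : IsMonomialOrder lt) {a b p q : Fin N → ℕ}
    (ha : lt p a ∨ p = a) (hb : lt q b ∨ q = b) (hne : p ≠ a ∨ q ≠ b) : lt (p + q) (a + b) := by
  have add' : ∀ a b c, lt a b → lt (c + a) (c + b) := fun a b c hab => by
    rw [add_comm c, add_comm c]
    exact h.add _ _ _ hab
  rcases ha with ha | rfl
  · rcases hb with hb | rfl
    · exact h.trans _ _ _ (h.add _ _ q ha) (add' _ _ a hb)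
    · exact h.add _ _ _ ha
  · rcases hb with hb | rfl
    · exact add' _ _ _ hb
    · simp at hne

end Orders

/-! ### Essential bases -/

section Basis

variable {ι V : Type*} [AddCommGroup V] [Module ℂ V] {lt : ι → ι → Prop} (w : ι → V)

/-- The indices of the vectors that are not in the span of the smaller ones. -/
def essentialSet (lt : ι → ι → Prop) : Set ι :=
  {m | Submodule.span ℂ {x | ∃ k, lt k m ∧ x = w k} ≠
    Submodule.span ℂ {x | ∃ k, (lt k m ∨ k = m) ∧ x = w k}}

variable {w}

lemma mem_essentialSet {m : ι} :
    m ∈ essentialSet w lt ↔ w m ∉ Submodule.span ℂ {x | ∃ k, lt k m ∧ x = w k} := by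
  refine ⟨fun h hm => h (le_antisymm (Submodule.span_mono ?_) (Submodule.span_le.2 ?_)),
    fun h heq => h ?_⟩
  · rintro _ ⟨k, hk, rfl⟩
    exact ⟨k, Or.inl hk, rfl⟩
  · rintro _ ⟨k, hk | rfl, rfl⟩
    · exact Submodule.subset_span ⟨k, hk, rfl⟩
    · exact hm
  · rw [heq]
    exact Submodule.subset_span ⟨m, Or.inr rfl, rfl⟩

/-- Well-founded induction: a vector with inessential index is a combination of vectors with smaller
indices. -/
lemma mem_span_essentialSet (hwf : WellFounded lt) (htr : ∀ a b c, lt a b → lt b c → lt a c)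
    (m : ι) : w m ∈ Submodule.span ℂ {x | ∃ k ∈ essentialSet w lt, (lt k m ∨ k = m) ∧ x = w k} := by
  induction m using hwf.induction with
  | h m ih =>
    by_cases hm : m ∈ essentialSet w lt
    · exact Submodule.subset_span ⟨m, hm, Or.inr rfl, rfl⟩
    · rw [mem_essentialSet, not_not] at hm
      refine Submodule.span_le.2 ?_ hm
      rintro _ ⟨k, hk, rfl⟩
      refine Submodule.span_mono ?_ (ih k hk)
      rintro _ ⟨j, hj, hjk, rfl⟩
      refine ⟨j, hj, Or.inl ?_, rfl⟩
      rcases hjk with h | rfl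
      · exact htr _ _ _ h hk
      · exact hk

/-- In a nontrivial relation, the vector with the largest index of nonzero coefficient would lie in
the span of smaller ones. -/
lemma linearIndependent_essentialSet (hir : ∀ a, ¬ lt a a)
    (htr : ∀ a b c, lt a b → lt b c → lt a c) (htot : ∀ a b, lt a b ∨ a = b ∨ lt b a) :
    LinearIndependent ℂ fun p : essentialSet w lt => w p := by
  classical
  rw [linearIndependent_iff']
  intro s g hg
  by_contra! hcon
  obtain ⟨i, his, hi⟩ := hcon
  let t := s.filter fun j => g j ≠ 0
  -- The order is reversed, so that a minimal element for `r` is a largest index.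
  let r : t → t → Prop := fun a b => lt (b : essentialSet w lt) (a : essentialSet w lt)
  have : IsTrans _ r := ⟨fun a b c hab hbc => htr _ _ _ hbc hab⟩
  have : Std.Irrefl r := ⟨fun a => hir _⟩
  obtain ⟨⟨p, hp⟩, -, hmax⟩ := (Finite.wellFounded_of_trans_of_irrefl r).has_min Set.univ
    ⟨⟨i, Finset.mem_filter.2 ⟨his, hi⟩⟩, trivial⟩
  obtain ⟨hps, hgp⟩ := Finset.mem_filter.1 hp
  refine mem_essentialSet.1 p.2 ?_
  rw [← Finset.add_sum_erase s _ hps, add_eq_zero_iff_eq_neg] at hg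
  have h1 : w p = (g p)⁻¹ • (g p • w p) := by rw [smul_smul, inv_mul_cancel₀ hgp, one_smul]
  rw [h1, hg]
  refine Submodule.smul_mem _ _ (Submodule.neg_mem _ (Submodule.sum_mem _ fun j hj => ?_))
  obtain ⟨hjp, hjs⟩ := Finset.mem_erase.1 hj
  by_cases hgj : g j = 0
  · rw [hgj, zero_smul]
    exact Submodule.zero_mem _
  · refine Submodule.smul_mem _ _ (Submodule.subset_span ⟨j, ?_, rfl⟩)
    rcases htot j p with h | h | h
    · exact h
    · exact absurd (Subtype.ext h) hjp
    · exact absurd h (hmax ⟨j, Finset.mem_filter.2 ⟨hjs, hgj⟩⟩ trivial)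

lemma span_essentialSet (hwf : WellFounded lt) (htr : ∀ a b c, lt a b → lt b c → lt a c)
    (hw : Submodule.span ℂ (Set.range w) = ⊤) :
    ⊤ ≤ Submodule.span ℂ (Set.range fun p : essentialSet w lt => w p) := by
  rw [← hw, Submodule.span_le]
  rintro _ ⟨m, rfl⟩
  refine Submodule.span_mono ?_ (mem_span_essentialSet (lt := lt) hwf htr m)
  rintro _ ⟨k, hk, -, rfl⟩
  exact ⟨⟨k, hk⟩, rfl⟩

/-- Triangularity: `w m` involves only essential vectors with index at most `m`. -/
lemma coord_eq_zero_of_not_le (hwf : WellFounded lt) (htr : ∀ a b c, lt a b → lt b c → lt a c)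
    (B : Module.Basis (essentialSet w lt) ℂ V) (hB : ∀ p, B p = w p) {p : essentialSet w lt}
    {m : ι} (h : B.coord p (w m) ≠ 0) : lt p m ∨ (p : ι) = m := by
  classical
  by_contra hcon
  apply h
  have hle : Submodule.span ℂ {x | ∃ k ∈ essentialSet w lt, (lt k m ∨ k = m) ∧ x = w k} ≤
      LinearMap.ker (B.coord p) := by
    refine Submodule.span_le.2 ?_
    rintro _ ⟨k, hk, hkm, rfl⟩
    have : w k = B ⟨k, hk⟩ := (hB ⟨k, hk⟩).symm
    rw [SetLike.mem_coe, LinearMap.mem_ker, this, Module.Basis.coord_apply,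
      Module.Basis.repr_self, Finsupp.single_apply, if_neg]
    rintro rfl
    exact hcon hkm
  exact hle (mem_span_essentialSet hwf htr m)

end Basis

/-! ### Comparison of coefficients -/

/-- Polynomial functions over an infinite field determine their coefficients. The exponent maps need
not be injective: in a product, several pairs of exponents have the same sum. -/
lemma sum_filter_eq_of_eval_eq {N : ℕ} {κ κ' : Type*} {s : Finset κ} {t : Finset κ'}
    {e : κ → Fin N → ℕ} {e' : κ' → Fin N → ℕ} {c : κ → ℂ} {c' : κ' → ℂ}
    (h : ∀ z : Fin N → ℂ, ∑ k ∈ s, (∏ i, z i ^ e k i) * c k = ∑ k ∈ t, (∏ i, z i ^ e' k i) * c' k)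
    (m : Fin N → ℕ) : ∑ k ∈ s with e k = m, c k = ∑ k ∈ t with e' k = m, c' k := by
  let φ : (Fin N → ℕ) ≃ (Fin N →₀ ℕ) := Finsupp.equivFunOnFinite.symm
  have hpoly : ∑ k ∈ s, monomial (φ (e k)) (c k) = ∑ k ∈ t, monomial (φ (e' k)) (c' k) := by
    refine MvPolynomial.funext fun z => ?_
    have hev : ∀ (a : Fin N → ℕ) (b : ℂ), eval z (monomial (φ a) b) = (∏ i, z i ^ a i) * b := by
      intro a b
      rw [eval_monomial, mul_comm, Finsupp.prod_fintype _ _ fun i => pow_zero _]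
      rfl
    rw [map_sum, map_sum]
    simp only [hev]
    exact h z
  have := congrArg (coeff (φ m)) hpoly
  rw [coeff_sum, coeff_sum] at this
  simpa only [coeff_monomial, φ.injective.eq_iff, ← Finset.sum_filter] using this

end DualEssential

end

noncomputable section

namespace DualEssential

variable {n : ℕ} {G : Subgroup (GLC n)} {D : CartanDecomposition G}

/-! ### Essential monomials of irreducible representations -/

namespace CartanDecomposition.IsHighestWeightRep

variable {V : Type*} [AddCommGroup V] [Module ℂ V] {ρ : Representation ℂ G V}
  {χ : charLattice D.T} {v : V} (h : D.IsHighestWeightRep χ ρ v)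

include h in
lemma span_orbit_eq_top : Submodule.span ℂ (Set.range fun g => ρ g v) = ⊤ := by
  let S : Subrepresentation ρ :=
    { toSubmodule := Submodule.span ℂ (Set.range fun g => ρ g v)
      apply_mem_toSubmodule := fun g w hw => by
        induction hw using Submodule.span_induction with
        | mem w hw =>
          obtain ⟨k, rfl⟩ := hw
          dsimp only
          rw [← Module.End.mul_apply, ← map_mul]
          exact Submodule.subset_span ⟨_, rfl⟩
        | zero => simp
        | add a b _ _ ha hb => rw [map_add]; exact Submodule.add_mem _ ha hb
        | smul c a _ ha => rw [map_smul]; exact Submodule.smul_mem _ c ha }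
  have := h.irreducible
  rcases eq_bot_or_eq_top S with hS | hS
  · exfalso
    apply h.ne_zero
    have h1 : v ∈ S.toSubmodule := Submodule.subset_span ⟨1, by simp⟩
    rw [hS] at h1
    exact h1
  · exact congrArg Subrepresentation.toSubmodule hS

/-- `toFun` as a linear map. -/
def toFunLin : Module.Dual ℂ V →ₗ[ℂ] D.coordRingModU where
  toFun := h.toFun
  map_add' _ _ := rfl
  map_smul' _ _ := rfl

/-- By irreducibility the orbit of `v` spans `V`. -/
lemma toFunLin_injective : Function.Injective h.toFunLin := by
  rw [injective_iff_map_eq_zero]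
  intro ξ hξ
  have h1 : ∀ g, ξ (ρ g v) = 0 := fun g => congrFun (congrArg Subtype.val hξ) g
  refine LinearMap.ext fun w => ?_
  have h2 : Submodule.span ℂ (Set.range fun g => ρ g v) ≤ LinearMap.ker ξ := by
    refine Submodule.span_le.2 ?_
    rintro _ ⟨g, rfl⟩
    exact h1 g
  exact h2 (h.span_orbit_eq_top ▸ Submodule.mem_top)

include h in
lemma isPrimitiveVector : IsPrimitiveVector D ρ χ v := ⟨h.weight, h.unipotent⟩

variable [FiniteDimensional ℂ V]

variable {f : D.RootVectors} {N : ℕ} {S : Fin N → D.pos}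
  {lt : (Fin N → ℕ) → (Fin N → ℕ) → Prop}

include h in
theorem exists_isEssentialBasis (hG : IsConnectedReductive G) (hS : IsBirationalSequence f S)
    (hlt : IsMonomialOrder lt) :
    ∃ B : Module.Basis (es f S lt ρ v) ℂ V, IsEssentialBasis f S lt ρ v B := by
  have hspan : Submodule.span ℂ (Set.range fun m => monomialOp f S ρ m v) = ⊤ := by
    rw [eq_top_iff, ← h.span_orbit_eq_top, Submodule.span_le]
    rintro _ ⟨g, rfl⟩
    exact rep_mem_span_monomialOp hG h.rational h.isPrimitiveVector hS g
  exact ⟨Module.Basis.mk (linearIndependent_essentialSet (lt := lt)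
    (w := fun m => monomialOp f S ρ m v) hlt.irrefl hlt.trans hlt.total)
    (span_essentialSet hlt.wellFounded hlt.trans hspan), fun p => Module.Basis.mk_apply _ _ p⟩

end CartanDecomposition.IsHighestWeightRep

/-! ### Triangularity of essential bases. -/

section Essential

variable {V : Type*} [AddCommGroup V] [Module ℂ V] [FiniteDimensional ℂ V]
  {ρ : Representation ℂ G V} {v : V} {f : D.RootVectors} {N : ℕ} {S : Fin N → D.pos}
  {lt : (Fin N → ℕ) → (Fin N → ℕ) → Prop} {B : Module.Basis (es f S lt ρ v) ℂ V}

lemma IsEssentialBasis.coord_self (hB : IsEssentialBasis f S lt ρ v B) (p : es f S lt ρ v) :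
    B.coord p (monomialOp f S ρ p v) = 1 := by
  rw [← hB p, Module.Basis.coord_apply, Module.Basis.repr_self, Finsupp.single_eq_same]

lemma IsEssentialBasis.le_of_coord_ne_zero (hB : IsEssentialBasis f S lt ρ v B)
    (hlt : IsMonomialOrder lt) {p : es f S lt ρ v} {m : Fin N → ℕ}
    (h : B.coord p (monomialOp f S ρ m v) ≠ 0) : lt p m ∨ (p : Fin N → ℕ) = m :=
  coord_eq_zero_of_not_le (w := fun m => monomialOp f S ρ m v) hlt.wellFounded hlt.trans B hB h

/-- A linear form that vanishes on all smaller monomials, but not on that of `m`, shows that `m`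
is essential. -/
lemma mem_es_of_dual {ζ : Module.Dual ℂ V} {m : Fin N → ℕ}
    (h0 : ∀ k, lt k m → ζ (monomialOp f S ρ k v) = 0) (h1 : ζ (monomialOp f S ρ m v) ≠ 0) :
    m ∈ es f S lt ρ v := by
  refine (mem_essentialSet (w := fun m => monomialOp f S ρ m v)).2 fun hm => h1 ?_
  have hle : Submodule.span ℂ {x | ∃ k, lt k m ∧ x = monomialOp f S ρ k v} ≤ LinearMap.ker ζ := by
    refine Submodule.span_le.2 ?_
    rintro _ ⟨k, hk, rfl⟩
    exact h0 k hk
  exact hle hm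

end Essential

/-! ### Smallest monomials of products. -/

section Product

variable {V₁ V₂ V₃ : Type*}
    [AddCommGroup V₁] [Module ℂ V₁] [FiniteDimensional ℂ V₁]
    [AddCommGroup V₂] [Module ℂ V₂] [FiniteDimensional ℂ V₂]
    [AddCommGroup V₃] [Module ℂ V₃] [FiniteDimensional ℂ V₃]
    {ρ₁ : Representation ℂ G V₁} {ρ₂ : Representation ℂ G V₂} {ρ₃ : Representation ℂ G V₃}
    {v₁ : V₁} {v₂ : V₂} {v₃ : V₃} {f : D.RootVectors} {N : ℕ} {S : Fin N → D.pos}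
    {lt : (Fin N → ℕ) → (Fin N → ℕ) → Prop}
    {B₁ : Module.Basis (es f S lt ρ₁ v₁) ℂ V₁} {B₂ : Module.Basis (es f S lt ρ₂ v₂) ℂ V₂}

/-- The values on monomials of a linear form that represents a product of matrix coefficients. -/
lemma exists_dual_monomialOp_eq (r₁ : IsRational ρ₁) (r₂ : IsRational ρ₂) (r₃ : IsRational ρ₃)
    {ξ : Module.Dual ℂ V₁} {η : Module.Dual ℂ V₂} {ζ : Module.Dual ℂ V₃}
    (hζ : ∀ g, ζ (ρ₃ g v₃) = ξ (ρ₁ g v₁) * η (ρ₂ g v₂)) (f : D.RootVectors) (S : Fin N → D.pos) :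
    ∃ A : Finset ((Fin N → ℕ) × (Fin N → ℕ)),
      (∀ a b, (a, b) ∉ A → ξ (monomialOp f S ρ₁ a v₁) * η (monomialOp f S ρ₂ b v₂) = 0) ∧
      ∀ m, ζ (monomialOp f S ρ₃ m v₃) = ∑ ab ∈ A with ab.1 + ab.2 = m,
        ξ (monomialOp f S ρ₁ ab.1 v₁) * η (monomialOp f S ρ₂ ab.2 v₂) := by
  obtain ⟨A₁, h₁, e₁⟩ := rep_prodElt r₁ f S
  obtain ⟨A₂, h₂, e₂⟩ := rep_prodElt r₂ f S
  obtain ⟨A₃, h₃, e₃⟩ := rep_prodElt r₃ f S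
  refine ⟨A₁ ×ˢ A₂, fun a b hab => ?_, fun m => ?_⟩
  · rw [Finset.mem_product, not_and_or] at hab
    rcases hab with h | h
    · rw [h₁ a h, LinearMap.zero_apply, map_zero, zero_mul]
    · rw [h₂ b h, LinearMap.zero_apply, map_zero, mul_zero]
  -- The hypothesis at a product of exponentials is an identity of polynomials in `z`; the
  -- coefficients of `z^m` are compared.
  · have key := sum_filter_eq_of_eval_eq (s := A₃) (t := A₁ ×ˢ A₂) (e := id)
      (e' := fun ab => ab.1 + ab.2) (c := fun m => ζ (monomialOp f S ρ₃ m v₃))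
      (c' := fun ab => ξ (monomialOp f S ρ₁ ab.1 v₁) * η (monomialOp f S ρ₂ ab.2 v₂))
      (fun z => by
        have h := hζ (prodElt f S z)
        rw [e₁, e₂, e₃] at h
        simp only [LinearMap.sum_apply, LinearMap.smul_apply, map_sum, map_smul,
          smul_eq_mul] at h
        simp only [id]
        rw [h, Finset.sum_mul_sum, Finset.sum_product]
        refine Finset.sum_congr rfl fun a _ => Finset.sum_congr rfl fun b _ => ?_
        simp only [Pi.add_apply, pow_add, Finset.prod_mul_distrib]
        ring) m
    rw [← key, Finset.sum_filter]
    simp only [id]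
    rw [Finset.sum_ite_eq']
    split_ifs with hm
    · rfl
    · rw [h₃ m hm, LinearMap.zero_apply, map_zero]

/-- The two factors have smallest monomials `z^p` and `z^q` with coefficient 1. Only the pair `(p,
q)` contributes to `z^(p+q)`, since every other contributing pair has a strictly larger sum. -/
lemma dual_monomialOp_mul (hlt : IsMonomialOrder lt)
    (r₁ : IsRational ρ₁) (r₂ : IsRational ρ₂) (r₃ : IsRational ρ₃)
    (hB₁ : IsEssentialBasis f S lt ρ₁ v₁ B₁) (hB₂ : IsEssentialBasis f S lt ρ₂ v₂ B₂)
    {p : es f S lt ρ₁ v₁} {q : es f S lt ρ₂ v₂} {ζ : Module.Dual ℂ V₃}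
    (hζ : ∀ g, ζ (ρ₃ g v₃) = B₁.coord p (ρ₁ g v₁) * B₂.coord q (ρ₂ g v₂)) :
    ζ (monomialOp f S ρ₃ ((p : Fin N → ℕ) + q) v₃) = 1 ∧
      ∀ m, ζ (monomialOp f S ρ₃ m v₃) ≠ 0 →
        lt ((p : Fin N → ℕ) + q) m ∨ (p : Fin N → ℕ) + q = m := by
  obtain ⟨A, hA, hm⟩ := exists_dual_monomialOp_eq r₁ r₂ r₃ hζ f S
  have hle : ∀ a b, B₁.coord p (monomialOp f S ρ₁ a v₁) * B₂.coord q (monomialOp f S ρ₂ b v₂) ≠ 0 →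
      ((p : Fin N → ℕ) ≠ a ∨ (q : Fin N → ℕ) ≠ b) → lt ((p : Fin N → ℕ) + q) (a + b) :=
    fun a b hab hne => hlt.add_lt_add
      (hB₁.le_of_coord_ne_zero hlt (left_ne_zero_of_mul hab))
      (hB₂.le_of_coord_ne_zero hlt (right_ne_zero_of_mul hab)) hne
  constructor
  · rw [hm, Finset.sum_eq_single ((p : Fin N → ℕ), (q : Fin N → ℕ))]
    · rw [hB₁.coord_self, hB₂.coord_self, one_mul]
    · rintro ⟨a, b⟩ hab hne
      by_contra hcon
      have h1 := hle a b hcon (by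
        by_contra! h
        exact hne (Prod.ext h.1.symm h.2.symm))
      have h2 : a + b = (p : Fin N → ℕ) + q := (Finset.mem_filter.1 hab).2
      exact hlt.irrefl _ (h2 ▸ h1)
    · intro hpq
      refine hA _ _ fun h => hpq (Finset.mem_filter.2 ⟨h, rfl⟩)
  · intro m hne
    rw [hm] at hne
    obtain ⟨⟨a, b⟩, hab, h⟩ := Finset.exists_ne_zero_of_sum_ne_zero hne
    obtain ⟨-, rfl⟩ := Finset.mem_filter.1 hab
    by_cases hpq : (p : Fin N → ℕ) = a ∧ (q : Fin N → ℕ) = b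
    · exact Or.inr (by rw [hpq.1, hpq.2])
    · exact Or.inl (hle a b h (not_and_or.1 hpq))

end Product

end DualEssential

end

/-! ### The main theorem. -/

theorem mainTheorem3 {n : ℕ} (G : Subgroup (DualEssential.GLC n))
    (hG : DualEssential.IsConnectedReductive G)
    (D : DualEssential.CartanDecomposition G) (f : D.RootVectors)
    {N : ℕ} (hN : N = D.pos.ncard) (S : Fin N → D.pos)
    (hS : DualEssential.CartanDecomposition.IsBirationalSequence f S)
    (lt : (Fin N → ℕ) → (Fin N → ℕ) → Prop) (hlt : DualEssential.IsWeightedLexOrder lt)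
    {V₁ V₂ V₃ : Type*}
    [AddCommGroup V₁] [Module ℂ V₁] [FiniteDimensional ℂ V₁]
    [AddCommGroup V₂] [Module ℂ V₂] [FiniteDimensional ℂ V₂]
    [AddCommGroup V₃] [Module ℂ V₃] [FiniteDimensional ℂ V₃]
    (wt₁ wt₂ : DualEssential.charLattice D.T)
    (ρ₁ : Representation ℂ G V₁) (v₁ : V₁) (h₁ : D.IsHighestWeightRep wt₁ ρ₁ v₁)
    (ρ₂ : Representation ℂ G V₂) (v₂ : V₂) (h₂ : D.IsHighestWeightRep wt₂ ρ₂ v₂)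
    (ρ₃ : Representation ℂ G V₃) (v₃ : V₃) (h₃ : D.IsHighestWeightRep (wt₁ * wt₂) ρ₃ v₃) :
    ∃ (B₁ : Module.Basis (DualEssential.es f S lt ρ₁ v₁) ℂ V₁)
      (B₂ : Module.Basis (DualEssential.es f S lt ρ₂ v₂) ℂ V₂)
      (B₃ : Module.Basis (DualEssential.es f S lt ρ₃ v₃) ℂ V₃),
      DualEssential.IsEssentialBasis f S lt ρ₁ v₁ B₁ ∧
      DualEssential.IsEssentialBasis f S lt ρ₂ v₂ B₂ ∧
      DualEssential.IsEssentialBasis f S lt ρ₃ v₃ B₃ ∧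
      ∀ (p : DualEssential.es f S lt ρ₁ v₁) (q : DualEssential.es f S lt ρ₂ v₂),
        ∃ (hpq : (p : Fin N → ℕ) + (q : Fin N → ℕ) ∈ DualEssential.es f S lt ρ₃ v₃)
          (c : DualEssential.es f S lt ρ₃ v₃ →₀ ℂ),
          (∀ c' : DualEssential.es f S lt ρ₃ v₃ →₀ ℂ,
            DualEssential.xi h₁ B₁ p * DualEssential.xi h₂ B₂ q =
              c'.sum (fun r a => a • DualEssential.xi h₃ B₃ r) ↔ c' = c) ∧
          DualEssential.xi h₁ B₁ p * DualEssential.xi h₂ B₂ q =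
            DualEssential.xi h₃ B₃ ⟨(p : Fin N → ℕ) + (q : Fin N → ℕ), hpq⟩ +
              ∑ᶠ r ∈ {r : DualEssential.es f S lt ρ₃ v₃ |
                  lt ((p : Fin N → ℕ) + (q : Fin N → ℕ)) (r : Fin N → ℕ)},
                c r • DualEssential.xi h₃ B₃ r := by
  have ho := hlt.isMonomialOrder
  obtain ⟨B₁, hB₁⟩ := h₁.exists_isEssentialBasis hG hS ho
  obtain ⟨B₂, hB₂⟩ := h₂.exists_isEssentialBasis hG hS ho
  obtain ⟨B₃, hB₃⟩ := h₃.exists_isEssentialBasis hG hS ho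
  refine ⟨B₁, B₂, B₃, hB₁, hB₂, hB₃, fun p q => ?_⟩
  obtain ⟨ζ, hζ⟩ := DualEssential.exists_dual_mul hG hS h₁.rational h₂.rational h₃.rational
    h₁.isPrimitiveVector h₂.isPrimitiveVector h₃.isPrimitiveVector h₃.ne_zero
    (B₁.coord p) (B₂.coord q)
  obtain ⟨hone, hle⟩ := DualEssential.dual_monomialOp_mul ho h₁.rational h₂.rational h₃.rational
    hB₁ hB₂ hζ
  have hpq : (p : Fin N → ℕ) + (q : Fin N → ℕ) ∈ DualEssential.es f S lt ρ₃ v₃ := by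
    refine DualEssential.mem_es_of_dual (ζ := ζ) (fun k hk => ?_) (by rw [hone]; exact one_ne_zero)
    by_contra hne
    rcases hle k hne with h | h
    · exact ho.irrefl _ (ho.trans _ _ _ h hk)
    · exact ho.irrefl _ (h ▸ hk)
  classical
  have : Finite (DualEssential.es f S lt ρ₃ v₃) := Module.Finite.finite_basis B₃
  have := Fintype.ofFinite (DualEssential.es f S lt ρ₃ v₃)
  -- The coefficients of a form in the dual basis are its values on the basis.
  let c : DualEssential.es f S lt ρ₃ v₃ →₀ ℂ := Finsupp.equivFunOnFinite.symm fun r => ζ (B₃ r)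
  have hc : ∀ r, c r = ζ (B₃ r) := fun _ => rfl
  have hprod : DualEssential.xi h₁ B₁ p * DualEssential.xi h₂ B₂ q = h₃.toFunLin ζ :=
    Subtype.ext (funext fun g => (hζ g).symm)
  have hsum : ∀ c' : DualEssential.es f S lt ρ₃ v₃ →₀ ℂ,
      c'.sum (fun r a => a • DualEssential.xi h₃ B₃ r) =
        h₃.toFunLin (c'.sum fun r a => a • B₃.coord r) := fun c' => by
    rw [Finsupp.sum, Finsupp.sum, map_sum]
    exact Finset.sum_congr rfl fun r _ => (map_smul h₃.toFunLin _ _).symm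
  have heval : ∀ (c' : DualEssential.es f S lt ρ₃ v₃ →₀ ℂ) r,
      (c'.sum fun r a => a • B₃.coord r) (B₃ r) = c' r := fun c' r => by
    rw [Finsupp.sum, LinearMap.sum_apply]
    simp only [LinearMap.smul_apply, Module.Basis.coord_apply, Module.Basis.repr_self,
      Finsupp.single_apply, smul_eq_mul, mul_ite, mul_one, mul_zero]
    rw [Finset.sum_ite_eq]
    split_ifs with h
    · rfl
    · exact (Finsupp.notMem_support_iff.1 h).symm
  have huniq : ∀ c' : DualEssential.es f S lt ρ₃ v₃ →₀ ℂ,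
      DualEssential.xi h₁ B₁ p * DualEssential.xi h₂ B₂ q =
        c'.sum (fun r a => a • DualEssential.xi h₃ B₃ r) ↔ c' = c := fun c' => by
    -- Injectivity of `toFunLin` turns an identity of regular functions into one of linear forms.
    rw [hprod, hsum, h₃.toFunLin_injective.eq_iff]
    constructor
    · intro h
      ext r
      rw [hc, h, heval]
    · rintro rfl
      exact B₃.ext fun r => by rw [heval, hc]
  refine ⟨hpq, c, huniq, ?_⟩
  -- All terms are written as sums over the finite set of essential exponents and compared one by
  -- one: `c` is 1 at `p + q` and 0 at every other `r` that is not larger.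
  rw [(huniq c).2 rfl, Finsupp.sum_fintype c (fun r a => a • DualEssential.xi h₃ B₃ r) fun r => zero_smul _ _, finsum_mem_def,
    finsum_eq_sum_of_fintype,
    ← Fintype.sum_ite_eq' (⟨(p : Fin N → ℕ) + (q : Fin N → ℕ), hpq⟩ :
      DualEssential.es f S lt ρ₃ v₃) (DualEssential.xi h₃ B₃), ← Finset.sum_add_distrib]
  refine Finset.sum_congr rfl fun r _ => ?_
  by_cases hr : r = ⟨(p : Fin N → ℕ) + (q : Fin N → ℕ), hpq⟩
  · subst hr
    rw [if_pos rfl, Set.indicator_of_notMem (s := {r : DualEssential.es f S lt ρ₃ v₃ |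
      lt ((p : Fin N → ℕ) + (q : Fin N → ℕ)) (r : Fin N → ℕ)}) (ho.irrefl _), add_zero, hc, hB₃, hone, one_smul]
  · rw [if_neg hr, zero_add]
    by_cases hrl : lt ((p : Fin N → ℕ) + (q : Fin N → ℕ)) (r : Fin N → ℕ)
    · rw [Set.indicator_of_mem (s := {r : DualEssential.es f S lt ρ₃ v₃ |
        lt ((p : Fin N → ℕ) + (q : Fin N → ℕ)) (r : Fin N → ℕ)}) hrl]
    · rw [Set.indicator_of_notMem (s := {r : DualEssential.es f S lt ρ₃ v₃ |
        lt ((p : Fin N → ℕ) + (q : Fin N → ℕ)) (r : Fin N → ℕ)}) hrl]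
      have : c r = 0 := by
        by_contra hne
        rw [hc, hB₃] at hne
        rcases hle r hne with h | h
        · exact hrl h
        · exact hr (Subtype.ext h.symm)
      rw [this, zero_smul]
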